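/- Let $G$ be a directed acyclic graph with vertex set $\{0,\dots,n-1\}$ and $m$ arcs, and let $s$ be a vertex of $G$. Call $s$ a \emph{junction} of a pair of vertices $u,v$ if $u\ne v$ and there are directed paths in $G$ from $s$ to $u$ and from $s$ to $v$ that have only the vertex $s$ in common (one of the paths may be the one-vertex path, when $s=u$ or $s=v$); a vertex $v$ is a \emph{descendant} of $s$ if there is a directed path from $s$ to $v$ (so $s$ is a descendant of itself). The model of computation is a unit-cost random access machine with addition, truncated subtraction and comparison, whose memory is initially zero outside the input and whose words hold numbers of size $O(n+m+1)$; the input consists of $n$, $m$, $s$ and the adjacency lists of the out-neighbours of the vertices of $G$, stored consecutively in one array, together with the array of their starting positions. There are three fixed programs (construct, query, list) and a constant $C$, all independent of $G$ and $s$, such that the following holds for every such $G$, $s$ and every order of the adjacency lists. (1) The construction halts after at most $C(m+1)$ steps (that is, in time $O(m)$). It leaves in memory a disjoint-set structure on the descendants of $s$, given by an array $p$: for every descendant $v$ of $s$, $p[v]$ is again a descendant of $s$ with $p[p[v]]=p[v]$ (the representative of the set containing $v$), and for all descendants $u,v$ of $s$, the vertex $s$ is a junction of $u,v$ if and only if $p[u]\neq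 p[v]$. (2) After the construction, given any vertices $u,v$ of $G$, the query program decides in at most $C$ steps whether $s$ is a junction of $u,v$. It prints nothing and does not change the contents of the arrays. (3) After the construction, the list program prints all $k$ unordered pairs that have $s$ as a junction, each exactly once, in at most $C(k+1)$ steps (that is, in time $O(k)$). It does not change the contents of the arrays. -/

import Mathlib

/-! ## Directed acyclic graphs, directed paths, junctions -/

/-- A digraph is acyclic if no vertex can be reached from itself along one or more arcs. -/
def IsDAG {n : ℕ} (G : Digraph (Fin n)) : Prop :=
  ∀ v, ¬ Relation.TransGen G.Adj v v

/-- The number of arcs. -/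
noncomputable def arcCount {n : ℕ} (G : Digraph (Fin n)) : ℕ :=
  {e : Fin n × Fin n | G.Adj e.1 e.2}.ncard

/-- `P` is (the vertex sequence of) a directed path from `s` to `u`.  The one-vertex sequence `[s]`
is a directed path from `s` to `s`. -/
structure IsDirPath {n : ℕ} (G : Digraph (Fin n)) (s u : Fin n) (P : List (Fin n)) : Prop where
  head : P.head? = some s
  last : P.getLast? = some u
  chain : P.IsChain G.Adj
  nodup : P.Nodup

/-- `v` is a descendant of `s` (possibly `s` itself). -/
def IsDescendant {n : ℕ} (G : Digraph (Fin n)) (s v : Fin n) : Prop :=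
  Relation.ReflTransGen G.Adj s v

/-- `s` is a junction of the pair `u, v`: the two vertices are distinct and there are directed paths
from `s` to `u` and from `s` to `v` which have only the vertex `s` in common.  (So `u` may not be an
inner vertex of the path to `v`, nor `v` of the path to `u`; but `s = u` is allowed.) -/
def IsJunction {n : ℕ} (G : Digraph (Fin n)) (s u v : Fin n) : Prop :=
  u ≠ v ∧ ∃ P Q : List (Fin n), IsDirPath G s u P ∧ IsDirPath G s v Q ∧
    ∀ x, x ∈ P → x ∈ Q → x = s

/-- The set of unordered pairs that have `s` as a junction. -/
def junctionPairs {n : ℕ} (G : Digraph (Fin n)) (s : Fin n) : Set (Sym2 (Fin n)) :=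
  {z | ∃ u v, z = s(u, v) ∧ IsJunction G s u v}

/-- `p` is the parent array of a disjoint-set structure on the descendants of `s`, with all paths
compressed, whose sets decide junctions: `p[v]` is the representative of the set containing `v`,
a representative points to itself, and `s` is a junction of `u, v` exactly if `u` and `v` lie in
different sets. -/
structure IsDisjointSetArray {n : ℕ} (G : Digraph (Fin n)) (s : Fin n) (p : ℕ → ℕ) : Prop where
  rep : ∀ v : Fin n, IsDescendant G s v →
    ∃ r : Fin n, IsDescendant G s r ∧ p v = r ∧ p r = r
  junction_iff : ∀ u v : Fin n, IsDescendant G s u → IsDescendant G s v →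
    (IsJunction G s u v ↔ p u ≠ p v)

/-! ## A random access machine with bounded words and unit costs

The machine has registers, arrays and an output stream.  A program names finitely many
registers and arrays; array cells are addressed indirectly.  Arithmetic is restricted
to addition, truncated subtraction and comparison. -/

namespace RAM

/-- A machine state: registers, arrays (`arr a i` is the cell `i` of the array `a`), and the pairs
printed so far. -/
structure State where
  reg : ℕ → ℕ
  arr : ℕ → ℕ → ℕ
  out : List (ℕ × ℕ)

def State.setReg (σ : State) (x k : ℕ) : State :=
  { σ with reg := Function.update σ.reg x k }

def State.setCell (σ : State) (a i k : ℕ) : State :=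
  { σ with arr := Function.update σ.arr a (Function.update (σ.arr a) i k) }

def State.print (σ : State) (k l : ℕ) : State :=
  { σ with out := σ.out ++ [(k, l)] }

/-- Expressions. -/
inductive Expr where
  | lit (k : ℕ)
  | reg (x : ℕ)
  | get (a : ℕ) (i : Expr)
  | add (e f : Expr)
  | sub (e f : Expr)
  | lt (e f : Expr)
  | eq (e f : Expr)

/-- The value of an expression; comparisons give `1` (true) or `0` (false). -/
def Expr.val (σ : State) : Expr → ℕ
  | lit k => k
  | reg x => σ.reg x
  | get a i => σ.arr a (i.val σ)
  | add e f => e.val σ + f.val σ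
  | sub e f => e.val σ - f.val σ
  | lt e f => if e.val σ < f.val σ then 1 else 0
  | eq e f => if e.val σ = f.val σ then 1 else 0

/-- The number of elementary operations needed to evaluate an expression. -/
def Expr.cost : Expr → ℕ
  | lit _ => 1
  | reg _ => 1
  | get _ i => i.cost + 1
  | add e f => e.cost + f.cost + 1
  | sub e f => e.cost + f.cost + 1
  | lt e f => e.cost + f.cost + 1
  | eq e f => e.cost + f.cost + 1

/-- All values that occur in the evaluation, the addresses included, are at most `W`. -/
def Expr.Fits (W : ℕ) (σ : State) : Expr → Prop
  | lit k => k ≤ W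
  | reg x => σ.reg x ≤ W
  | get a i => i.Fits W σ ∧ σ.arr a (i.val σ) ≤ W
  | add e f => e.Fits W σ ∧ f.Fits W σ ∧ e.val σ + f.val σ ≤ W
  | sub e f => e.Fits W σ ∧ f.Fits W σ
  | lt e f => e.Fits W σ ∧ f.Fits W σ ∧ 1 ≤ W
  | eq e f => e.Fits W σ ∧ f.Fits W σ ∧ 1 ≤ W

/-- Programs. -/
inductive Cmd where
  | skip
  | assign (x : ℕ) (e : Expr)
  | store (a : ℕ) (i e : Expr)
  | print (e f : Expr)
  | seq (c d : Cmd)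
  | ite (b : Expr) (c d : Cmd)
  | while (b : Expr) (c : Cmd)

/-- `Exec W c σ t σ'`: on a machine whose words hold the numbers `0, …, W`, the program `c`, started
in the state `σ`, halts after `t` elementary steps in the state `σ'`.  A computation in which a
number greater than `W` occurs has no result. -/
inductive Exec (W : ℕ) : Cmd → State → ℕ → State → Prop
  | skip (σ : State) : Exec W .skip σ 1 σ
  | assign (σ : State) (x : ℕ) (e : Expr) (he : e.Fits W σ) :
      Exec W (.assign x e) σ (e.cost + 1) (σ.setReg x (e.val σ))
  | store (σ : State) (a : ℕ) (i e : Expr) (hi : i.Fits W σ) (he : e.Fits W σ) :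
      Exec W (.store a i e) σ (i.cost + e.cost + 1) (σ.setCell a (i.val σ) (e.val σ))
  | print (σ : State) (e f : Expr) (he : e.Fits W σ) (hf : f.Fits W σ) :
      Exec W (.print e f) σ (e.cost + f.cost + 1) (σ.print (e.val σ) (f.val σ))
  | seq {c d : Cmd} {σ₀ σ₁ σ₂ : State} {t₁ t₂ : ℕ}
      (hc : Exec W c σ₀ t₁ σ₁) (hd : Exec W d σ₁ t₂ σ₂) :
      Exec W (.seq c d) σ₀ (t₁ + t₂) σ₂
  | ite_true {b : Expr} {c d : Cmd} {σ σ' : State} {t : ℕ}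
      (hb : b.Fits W σ) (h : b.val σ ≠ 0) (hc : Exec W c σ t σ') :
      Exec W (.ite b c d) σ (b.cost + 1 + t) σ'
  | ite_false {b : Expr} {c d : Cmd} {σ σ' : State} {t : ℕ}
      (hb : b.Fits W σ) (h : b.val σ = 0) (hd : Exec W d σ t σ') :
      Exec W (.ite b c d) σ (b.cost + 1 + t) σ'
  | while_true {b : Expr} {c : Cmd} {σ₀ σ₁ σ₂ : State} {t₁ t₂ : ℕ}
      (hb : b.Fits W σ₀) (h : b.val σ₀ ≠ 0) (hc : Exec W c σ₀ t₁ σ₁)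
      (hw : Exec W (.while b c) σ₁ t₂ σ₂) :
      Exec W (.while b c) σ₀ (b.cost + 1 + t₁ + t₂) σ₂
  | while_false {b : Expr} {c : Cmd} {σ : State}
      (hb : b.Fits W σ) (h : b.val σ = 0) :
      Exec W (.while b c) σ (b.cost + 1) σ

end RAM

/-! ## The input -/

/-- `adj` is an adjacency list representation of `G`: `adj u` lists, in some order and without
repetition, the heads of the arcs that leave `u`. -/
structure IsAdjacencyList {n : ℕ} (G : Digraph (Fin n)) (adj : Fin n → List (Fin n)) : Prop where
  nodup : ∀ u, (adj u).Nodup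
  mem_iff : ∀ u v, v ∈ adj u ↔ G.Adj u v

/-- The start state: registers `0, 1, 2` hold the number of vertices, the number of arcs and the
vertex `s`; array `1` holds the concatenation of the adjacency lists, and the list of the vertex
`v` occupies in it the cells from `arr 0 v` up to, but not including, `arr 0 (v + 1)`.  Everything
else is zero. -/
def inputState {n : ℕ} (adj : Fin n → List (Fin n)) (s : Fin n) : RAM.State where
  reg x := if x = 0 then n
    else if x = 1 then (List.ofFn adj).flatten.length
    else if x = 2 then s
    else 0
  arr a i :=
    if a = 0 then (if i ≤ n then ((List.ofFn adj).take i).flatten.length else 0)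
    else if a = 1 then ((List.ofFn adj).flatten.map Fin.val).getD i 0
    else 0
  out := []

/-! Label the descendants of $s$ as follows: $s$ gets the label $s$; any other $v$ takes over the
common label of its predecessors among the descendants if they have one and it is not $s$, and
otherwise $v$ is its own label. These labels are the representatives `p` (`IsLabelling`).

Labels decide junctions. By induction along a path, the label of $v\ne s$ lies on every path from
$s$ to $v$ (`IsLabelling.mem_of_isDirPath`), so for equal labels all pairs of paths meet outside
$s$. Conversely, let the labels of $u,v$ differ, with $v$ not a proper ancestor of $u$. Some
predecessor $w$ of $v$ has a label different from that of $u$; by induction there are disjoint paths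
to $u$ and $w$, and the latter extends to $v$ without touching the former
(`IsLabelling.isJunction_of_ne`).

The labels are computed in time $O(m)$ by two traversals with the same loop
(`ArcSpec.runs_explore`). One counts, for each vertex, the arcs entering from descendants of $s$;
the other counts these down and queues a vertex when all of them have been treated, hence in
topological order, so that the labels of all tails are final when they are used (`LabelInv.visit`,
`LabelInv.push`). Only descendants of $s$ are touched, and each except $s$ is paid for by an arc, so
no term $n$ arises; this relies on memory being zero initially.

For the listing, the queued vertices are also linked to a ring starting at $s$ in which each set is
contiguous and its label comes first. For each $x\ne s$ in the ring, the vertices from $s$ up to the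
label of $x$, exclusive, are exactly the earlier vertices with another label
(`IsRing.exists_append_label`). Printing them with $x$ gives each pair once, and each row is
nonempty because it contains $s$, so the number of rows is at most the number of pairs
(`ListsPairs.concat`, `HasRing.runs_list`). -/

namespace RAM

/-! ### Rules for total correctness with time bounds -/

/-- From `σ`, the program `c` halts within `T` steps in a state satisfying `Q`. -/
def Runs (W : ℕ) (c : Cmd) (σ : State) (T : ℕ) (Q : State → Prop) : Prop :=
  ∃ t σ', Exec W c σ t σ' ∧ t ≤ T ∧ Q σ'

/-- Weakest precondition of a loop-free program. -/
def Cmd.wp (W : ℕ) : Cmd → (State → Prop) → State → Prop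
  | .skip, Q, σ => Q σ
  | .assign x e, Q, σ => e.Fits W σ ∧ Q (σ.setReg x (e.val σ))
  | .store a i e, Q, σ => i.Fits W σ ∧ e.Fits W σ ∧ Q (σ.setCell a (i.val σ) (e.val σ))
  | .print e f, Q, σ => e.Fits W σ ∧ f.Fits W σ ∧ Q (σ.print (e.val σ) (f.val σ))
  | .seq c d, Q, σ => c.wp W (d.wp W Q) σ
  | .ite b c d, Q, σ => b.Fits W σ ∧ (b.val σ ≠ 0 → c.wp W Q σ) ∧ (b.val σ = 0 → d.wp W Q σ)
  | .while _ _, _, _ => False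

/-- A bound on the running time of a loop-free program. -/
def Cmd.cost : Cmd → ℕ
  | .skip => 1
  | .assign _ e => e.cost + 1
  | .store _ i e => i.cost + e.cost + 1
  | .print e f => e.cost + f.cost + 1
  | .seq c d => c.cost + d.cost
  | .ite b c d => b.cost + 1 + (c.cost + d.cost)
  | .while _ _ => 0

variable {W : ℕ}

theorem Runs.mono {c : Cmd} {σ : State} {T T' : ℕ} {Q Q' : State → Prop}
    (h : Runs W c σ T Q) (hT : T ≤ T') (hQ : ∀ σ', Q σ' → Q' σ') : Runs W c σ T' Q' := by
  obtain ⟨t, σ', he, ht, hq⟩ := h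
  exact ⟨t, σ', he, ht.trans hT, hQ _ hq⟩

/-- Reduces every straight-line fragment to a computation by `simp` and `omega`. The bound charges
both branches of a conditional, which makes it independent of the state; loops have precondition
`False`, so their cost is irrelevant. -/
theorem Runs.of_wp {c : Cmd} : ∀ {σ : State} {Q : State → Prop}, c.wp W Q σ →
    Runs W c σ c.cost Q := by
  induction c with
  | skip => intro σ Q h; exact ⟨_, _, .skip σ, le_rfl, h⟩
  | assign x e => intro σ Q h; exact ⟨_, _, .assign σ x e h.1, le_rfl, h.2⟩
  | store a i e => intro σ Q h; exact ⟨_, _, .store σ a i e h.1 h.2.1, le_rfl, h.2.2⟩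
  | print e f => intro σ Q h; exact ⟨_, _, .print σ e f h.1 h.2.1, le_rfl, h.2.2⟩
  | seq c d hc hd =>
    intro σ Q h
    obtain ⟨t₁, σ₁, h₁, ht₁, hq₁⟩ := hc (σ := σ) h
    obtain ⟨t₂, σ₂, h₂, ht₂, hq₂⟩ := hd hq₁
    exact ⟨_, _, .seq h₁ h₂, Nat.add_le_add ht₁ ht₂, hq₂⟩
  | ite b c d hc hd =>
    intro σ Q h
    by_cases hb : b.val σ = 0
    · obtain ⟨t, σ', he, ht, hq⟩ := hd (h.2.2 hb)
      exact ⟨_, _, .ite_false h.1 hb he, by simp only [Cmd.cost]; omega, hq⟩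
    · obtain ⟨t, σ', he, ht, hq⟩ := hc (h.2.1 hb)
      exact ⟨_, _, .ite_true h.1 hb he, by simp only [Cmd.cost]; omega, hq⟩
  | _ => intro σ Q h; exact h.elim

theorem Runs.seq {c d : Cmd} {σ : State} {T₁ T₂ : ℕ} {Q R : State → Prop}
    (hc : Runs W c σ T₁ R) (hd : ∀ σ', R σ' → Runs W d σ' T₂ Q) :
    Runs W (.seq c d) σ (T₁ + T₂) Q := by
  obtain ⟨t₁, σ₁, h₁, ht₁, hq₁⟩ := hc
  obtain ⟨t₂, σ₂, h₂, ht₂, hq₂⟩ := hd _ hq₁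
  exact ⟨_, _, .seq h₁ h₂, Nat.add_le_add ht₁ ht₂, hq₂⟩

theorem Runs.while_false {b : Expr} {c : Cmd} {σ : State} {T : ℕ} {Q : State → Prop}
    (hf : b.Fits W σ) (hb : b.val σ = 0) (hT : b.cost + 1 ≤ T) (hQ : Q σ) :
    Runs W (.while b c) σ T Q :=
  ⟨_, _, .while_false hf hb, hT, hQ⟩

theorem Runs.while_true {b : Expr} {c : Cmd} {σ : State} {T₁ T₂ T : ℕ} {Q R : State → Prop}
    (hf : b.Fits W σ) (hb : b.val σ ≠ 0) (hc : Runs W c σ T₁ R)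
    (hw : ∀ σ', R σ' → Runs W (.while b c) σ' T₂ Q) (hT : b.cost + 1 + T₁ + T₂ ≤ T) :
    Runs W (.while b c) σ T Q := by
  obtain ⟨t₁, σ₁, h₁, ht₁, hq₁⟩ := hc
  obtain ⟨t₂, σ₂, h₂, ht₂, hq₂⟩ := hw _ hq₁
  exact ⟨_, _, .while_true hf hb h₁ h₂, by omega, hq₂⟩

/-- Total correctness of a loop whose remaining running time is bounded by a potential. -/
theorem Runs.while_potential {b : Expr} {c : Cmd} {Q : State → Prop} (I : State → ℕ → Prop)
    (hf : ∀ σ k, I σ k → b.Fits W σ)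
    (hstep : ∀ σ k, I σ k → b.val σ ≠ 0 → ∃ T k', b.cost + 1 + T + k' ≤ k ∧
      Runs W c σ T (fun σ' => ∃ k'' ≤ k', I σ' k''))
    (hend : ∀ σ k, I σ k → b.val σ = 0 → b.cost + 1 ≤ k ∧ Q σ) :
    ∀ k σ, I σ k → Runs W (.while b c) σ k Q := by
  intro k
  induction k using Nat.strong_induction_on with
  | _ k ih =>
    intro σ hI
    by_cases hb : b.val σ = 0
    · exact .while_false (hf _ _ hI) hb (hend _ _ hI hb).1 (hend _ _ hI hb).2
    · obtain ⟨T, k', hk, hr⟩ := hstep _ _ hI hb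
      refine .while_true (hf _ _ hI) hb hr ?_ hk
      rintro σ' ⟨k'', hk'', hI'⟩
      exact (ih k'' (by omega) σ' hI').mono hk'' fun _ h => h

end RAM

/-! ### Labels decide junctions -/

section Graph

variable {n : ℕ} {G : Digraph (Fin n)}

theorem IsDAG.nodup_of_isChain (hG : IsDAG G) {P : List (Fin n)} (h : P.IsChain G.Adj) :
    P.Nodup := by
  have h1 : P.IsChain (Relation.TransGen G.Adj) := h.imp fun _ _ => .single
  have h2 := h1.pairwise
  refine h2.imp ?_
  rintro a _ hab rfl
  exact hG a hab

theorem IsDirPath.reflTransGen_of_mem {s u : Fin n} {P : List (Fin n)} (h : IsDirPath G s u P)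
    {x : Fin n} (hx : x ∈ P) :
    Relation.ReflTransGen G.Adj s x ∧ Relation.ReflTransGen G.Adj x u := by
  have h1 : P.IsChain (Relation.ReflTransGen G.Adj) := h.chain.imp fun _ _ => .single
  have h2 := h1.pairwise
  obtain ⟨A, B, rfl⟩ := List.append_of_mem hx
  have hh := h.head
  have hl := h.last
  rw [List.pairwise_append] at h2
  constructor
  · cases A with
    | nil => simp at hh; subst hh; exact .refl
    | cons a A =>
      simp at hh; subst hh
      exact h2.2.2 a (by simp) x (by simp)
  · rcases List.eq_nil_or_concat B with rfl | ⟨B, b, rfl⟩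
    · simp at hl; subst hl; exact .refl
    · have : b = u := by simpa [List.getLast?_append, List.getLast?_cons] using hl
      subst this
      exact (List.pairwise_cons.1 h2.2.1).1 b (by simp)

theorem IsDirPath.singleton (s : Fin n) : IsDirPath G s s [s] :=
  ⟨rfl, rfl, List.isChain_singleton _, List.nodup_singleton _⟩

theorem IsDirPath.concat (hG : IsDAG G) {s w v : Fin n} {P : List (Fin n)}
    (h : IsDirPath G s w P) (hwv : G.Adj w v) : IsDirPath G s v (P ++ [v]) := by
  have hc : (P ++ [v]).IsChain G.Adj := by
    rw [List.isChain_append]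
    refine ⟨h.chain, List.isChain_singleton _, ?_⟩
    intro x hx y hy
    rw [h.last] at hx
    simp at hx hy
    subst hx; subst hy; exact hwv
  refine ⟨?_, by simp, hc, hG.nodup_of_isChain hc⟩
  have := h.head
  cases P <;> simp_all

theorem exists_isDirPath (hG : IsDAG G) {s v : Fin n} (h : IsDescendant G s v) :
    ∃ P, IsDirPath G s v P := by
  induction h with
  | refl => exact ⟨_, .singleton s⟩
  | tail _ hwv ih =>
    obtain ⟨P, hP⟩ := ih
    exact ⟨_, hP.concat hG hwv⟩

theorem IsJunction.symm {s u v : Fin n} (h : IsJunction G s u v) : IsJunction G s v u := by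
  obtain ⟨hne, P, Q, hP, hQ, hd⟩ := h
  exact ⟨hne.symm, Q, P, hQ, hP, fun x hx hy => hd x hy hx⟩

theorem IsJunction.isDescendant {s u v : Fin n} (h : IsJunction G s u v) :
    IsDescendant G s u ∧ IsDescendant G s v := by
  obtain ⟨-, P, Q, hP, hQ, -⟩ := h
  exact ⟨(hP.reflTransGen_of_mem (List.mem_of_getLast? hP.last)).1,
    (hQ.reflTransGen_of_mem (List.mem_of_getLast? hQ.last)).1⟩

/-- A labelling of the descendants of `s` in which every vertex other than `s` either takes over
the common label of all its predecessors, or, if these have no common label different from `s`,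
is its own label. -/
structure IsLabelling (G : Digraph (Fin n)) (s : Fin n) (p : Fin n → Fin n) : Prop where
  source : p s = s
  ne_source : ∀ v, IsDescendant G s v → v ≠ s → p v ≠ s
  pred : ∀ v, IsDescendant G s v → v ≠ s →
    (∀ w, IsDescendant G s w → G.Adj w v → p w = p v) ∨
    (p v = v ∧ ∀ c, c ≠ s → ∃ w, IsDescendant G s w ∧ G.Adj w v ∧ p w ≠ c)

/-- Induction on the path: either $v$ is its own label, or the penultimate vertex has the same
label. In the latter case that vertex is not $s$, whose label no other descendant carries, so the
induction hypothesis applies to the shorter path. -/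
theorem IsLabelling.mem_of_isDirPath {s : Fin n} {p : Fin n → Fin n} (hp : IsLabelling G s p)
    (P : List (Fin n)) : ∀ v, v ≠ s → IsDirPath G s v P → p v ∈ P := by
  induction P using List.reverseRecOn with
  | nil => intro v _ h; simpa using h.head
  | append_singleton P v' ih =>
    intro v hv h
    have hl := h.last
    simp at hl
    subst hl
    have hdv : IsDescendant G s v' := (h.reflTransGen_of_mem (x := v') (by simp)).1
    rcases hp.pred v' hdv hv with h1 | h1
    · rcases List.eq_nil_or_concat P with rfl | ⟨P', w, rfl⟩
      · have := h.head; simp at this; exact (hv this).elim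
      · have hc := h.chain
        rw [List.concat_eq_append] at *
        rw [List.isChain_append] at hc
        have hwv : G.Adj w v' := hc.2.2 w (by simp) v' (by simp)
        have hh : (P' ++ [w]).head? = some s := by
          have := h.head
          cases P' <;> simp_all
        have hw : IsDirPath G s w (P' ++ [w]) := by
          refine ⟨hh, by simp, hc.1, ?_⟩
          exact (List.nodup_append.1 h.nodup).1
        have hdw : IsDescendant G s w := (h.reflTransGen_of_mem (x := w) (by simp)).1
        have e := h1 w hdw hwv
        have hws : w ≠ s := by
          rintro rfl
          rw [hp.source] at e
          exact hp.ne_source v' hdv hv e.symm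
        have := ih w hws hw
        rw [← e]
        exact List.mem_append_left _ this
    · rw [h1.1]; simp

/-- The number of proper ancestors, which increases along the arcs of an acyclic graph. -/
noncomputable def ancestorCount (G : Digraph (Fin n)) (v : Fin n) : ℕ :=
  {x | Relation.TransGen G.Adj x v}.ncard

theorem IsDAG.ancestorCount_lt (hG : IsDAG G) {u v : Fin n} (h : Relation.TransGen G.Adj u v) :
    ancestorCount G u < ancestorCount G v := by
  apply Set.ncard_lt_ncard _ (Set.toFinite _)
  refine ⟨fun x hx => Relation.TransGen.trans hx h, fun hs => hG u (hs h)⟩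

/-- Induction on the total number of proper ancestors of the two vertices, replacing the vertex with
more ancestors by a suitable predecessor. -/
theorem IsLabelling.isJunction_of_ne (hG : IsDAG G) {s : Fin n} {p : Fin n → Fin n}
    (hp : IsLabelling G s p) : ∀ (k : ℕ) (u v : Fin n), ancestorCount G u + ancestorCount G v ≤ k →
    IsDescendant G s u → IsDescendant G s v → p u ≠ p v → IsJunction G s u v := by
  intro k
  induction k using Nat.strong_induction_on with
  | _ k ih =>
    intro u v hk hu hv hne
    -- The ancestor counts increase along arcs, so the vertex with the larger count is not a proper
    -- ancestor of the other.
    wlog hle : ancestorCount G u ≤ ancestorCount G v generalizing u v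
    · exact (this v u (by omega) hv hu hne.symm (by omega)).symm
    have huv : u ≠ v := fun e => hne (e ▸ rfl)
    have hvs : v ≠ s := by
      rintro rfl
      rcases Relation.reflTransGen_iff_eq_or_transGen.1 hu with e | h
      · exact huv e
      · have := hG.ancestorCount_lt h; omega
    by_cases hus : u = s
    · subst hus
      obtain ⟨Q, hQ⟩ := exists_isDirPath hG hv
      exact ⟨huv, _, Q, .singleton u, hQ, fun x hx _ => by simpa using hx⟩
    -- If $v$ inherited its label, any predecessor will do; if not, the predecessors do not all
    -- carry the label of $u$, which is not $s$.
    have key : ∃ w, IsDescendant G s w ∧ G.Adj w v ∧ p w ≠ p u := by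
      rcases hp.pred v hv hvs with h1 | h1
      · obtain ⟨w, hw, hwv⟩ : ∃ w, Relation.ReflTransGen G.Adj s w ∧ G.Adj w v := by
          rcases Relation.ReflTransGen.cases_tail hv with e | ⟨w, h, h'⟩
          · exact (hvs e).elim
          · exact ⟨w, h, h'⟩
        exact ⟨w, hw, hwv, by rw [h1 w hw hwv]; exact hne.symm⟩
      · exact h1.2 (p u) (hp.ne_source u hu hus)
    obtain ⟨w, hw, hwv, hwu⟩ := key
    have hlt := hG.ancestorCount_lt (.single hwv)
    obtain ⟨-, P, Q, hP, hQ, hd⟩ := ih (ancestorCount G u + ancestorCount G w) (by omega) u w le_rfl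
      hu hw hwu.symm
    refine ⟨huv, P, Q ++ [v], hP, hQ.concat hG hwv, ?_⟩
    intro x hx hxQ
    rcases List.mem_append.1 hxQ with h | h
    · exact hd x hx h
    · simp at h
      subst h
      -- If the new end $v$ were on the path to $u$, it would be a proper ancestor of $u$, against
      -- the choice of $v$.
      rcases Relation.reflTransGen_iff_eq_or_transGen.1 (hP.reflTransGen_of_mem hx).2 with e | h
      · exact (huv e).elim
      · have := hG.ancestorCount_lt h; omega

theorem IsLabelling.isJunction_iff (hG : IsDAG G) {s : Fin n} {p : Fin n → Fin n}
    (hp : IsLabelling G s p) {u v : Fin n} (hu : IsDescendant G s u) (hv : IsDescendant G s v) :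
    IsJunction G s u v ↔ p u ≠ p v := by
  refine ⟨fun ⟨hne, P, Q, hP, hQ, hd⟩ e => ?_, hp.isJunction_of_ne hG _ u v le_rfl hu hv⟩
  by_cases hus : u = s
  · subst hus
    rw [hp.source] at e
    exact hp.ne_source v hv hne.symm e.symm
  by_cases hvs : v = s
  · subst hvs
    rw [hp.source] at e
    exact hp.ne_source u hu hne e
  exact hp.ne_source u hu hus (hd _ (hp.mem_of_isDirPath P u hus hP)
    (e ▸ hp.mem_of_isDirPath Q v hvs hQ))

end Graph

open RAM

/-! ### Traversal of the arcs by a queue -/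

section Explore

variable {n : ℕ}

/-- The arrays `A₀` and `A₁` represent the adjacency lists `adj`, with `m` arcs in total. -/
structure HasAdjacency (adj : Fin n → List (Fin n)) (m : ℕ) (A₀ A₁ : ℕ → ℕ) : Prop where
  next : ∀ u : Fin n, A₀ (u + 1) = A₀ u + (adj u).length
  le : ∀ u : Fin n, A₀ (u + 1) ≤ m
  arc : ∀ (u : Fin n) (i : ℕ) (h : i < (adj u).length), A₁ (A₀ u + i) = (adj u)[i]
  sum : ∑ u, (adj u).length = m

/-- Array `2` and register `4` hold the queue `q`. -/
def HasQueue (q : List (Fin n)) (σ : State) : Prop :=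
  σ.reg 4 = q.length ∧ ∀ (i : ℕ) (h : i < q.length), σ.arr 2 i = q[i]

/-- The arcs with tail in `q`. -/
def arcsFrom (adj : Fin n → List (Fin n)) (q : List (Fin n)) : Set (Fin n × Fin n) :=
  {e | e.1 ∈ q ∧ e.2 ∈ adj e.1}

/-- Run through the out-neighbours of the vertex in register `5`. -/
def scanCmd (body : Cmd) : Cmd :=
  .while (.lt (.reg 6) (.reg 7))
    (.seq (.seq (.assign 8 (.get 1 (.reg 6))) (.assign 6 (.add (.reg 6) (.lit 1)))) body)

/-- Take the next vertex from the queue. -/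
def popCmd : Cmd :=
  .seq (.assign 5 (.get 2 (.reg 3))) (.seq (.assign 3 (.add (.reg 3) (.lit 1)))
    (.seq (.assign 6 (.get 0 (.reg 5))) (.assign 7 (.get 0 (.add (.reg 5) (.lit 1))))))

/-- Scan the out-neighbours of all vertices of the queue, which `body` may extend. -/
def exploreCmd (body : Cmd) : Cmd :=
  .while (.lt (.reg 3) (.reg 4)) (.seq popCmd (scanCmd body))

/-- What the treatment of a single arc has to achieve for an invariant `Inv` of the queue, the set
of the arcs treated so far, and the state. -/
structure ArcSpec (W : ℕ) (adj : Fin n → List (Fin n)) (body : Cmd) (K : ℕ)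
    (Inv : List (Fin n) → Set (Fin n × Fin n) → State → Prop) : Prop where
  nodup : ∀ q D σ, Inv q D σ → q.Nodup
  congr : ∀ q D σ σ', σ.reg 2 = σ'.reg 2 → σ.arr = σ'.arr → Inv q D σ → Inv q D σ'
  runs : ∀ q D σ u v, Inv q D σ → HasQueue q σ → u ∈ q → v ∈ adj u → (u, v) ∉ D →
    σ.reg 5 = u → σ.reg 8 = v →
    Runs W body σ K (fun σ' => (∃ q', (q' = q ∨ q' = q ++ [v]) ∧ Inv q' (insert (u, v) D) σ' ∧
      HasQueue q' σ') ∧ σ'.arr 0 = σ.arr 0 ∧ σ'.arr 1 = σ.arr 1 ∧ σ'.reg 3 = σ.reg 3 ∧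
      σ'.reg 5 = σ.reg 5 ∧ σ'.reg 6 = σ.reg 6 ∧ σ'.reg 7 = σ.reg 7)

variable {W m K : ℕ} {adj : Fin n → List (Fin n)} {body : Cmd}
  {Inv : List (Fin n) → Set (Fin n × Fin n) → State → Prop} {A₀ A₁ : ℕ → ℕ}

theorem HasQueue.congr {q : List (Fin n)} {σ σ' : State} (h : HasQueue q σ)
    (h4 : σ'.reg 4 = σ.reg 4) (ha : σ'.arr 2 = σ.arr 2) : HasQueue q σ' := by
  rw [HasQueue, h4, ha]; exact h

/-- Induction on the part `l` of the adjacency list still to be scanned. An arc costs `K` for the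
body and 11 for the loop test, the fetch and the increment; the last test costs 4. -/
theorem ArcSpec.runs_scan (hb : ArcSpec W adj body K Inv) (hA : HasAdjacency adj m A₀ A₁)
    (hW : n + m + 1 ≤ W) (h : ℕ) (u : Fin n) (hnd : (adj u).Nodup) :
    ∀ (l pre : List (Fin n)) (q : List (Fin n)) (D : Set (Fin n × Fin n)) (σ : State),
      adj u = pre ++ l → Inv q D σ → HasQueue q σ → u ∈ q → (∀ x ∈ l, (u, x) ∉ D) →
      σ.arr 0 = A₀ → σ.arr 1 = A₁ → σ.reg 3 = h → σ.reg 5 = u →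
      σ.reg 6 = A₀ u + pre.length → σ.reg 7 = A₀ u + (adj u).length →
      Runs W (scanCmd body) σ (l.length * (K + 11) + 4) (fun σ' =>
        (∃ ext : List (Fin n), ext.length ≤ l.length ∧
          Inv (q ++ ext) (D ∪ {e | e.1 = u ∧ e.2 ∈ l}) σ' ∧ HasQueue (q ++ ext) σ') ∧
        σ'.arr 0 = A₀ ∧ σ'.arr 1 = A₁ ∧ σ'.reg 3 = h) := by
  intro l
  induction l with
  | nil =>
    intro pre q D σ hl hI hq hu hD h0 h1 h3 h5 h6 h7
    have := hA.le u
    have := hA.next u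
    simp at hl
    subst hl
    refine .while_false ?_ ?_ (by simp [Expr.cost]) ⟨⟨[], by simp, ?_, by simpa using hq⟩, h0, h1, h3⟩
    · simp only [Expr.Fits, h6, h7]; omega
    · simp [Expr.val, h6, h7]
    · convert hI using 2 <;> simp
  | cons v l ih =>
    intro pre q D σ hl hI hq hu hD h0 h1 h3 h5 h6 h7
    have hle := hA.le u
    have hnx := hA.next u
    have hlen : (adj u).length = pre.length + (l.length + 1) := by rw [hl]; simp
    have harc : A₁ (A₀ u + pre.length) = v := by
      rw [hA.arc u pre.length (by omega)]; simp [hl]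
    have hv : v ∈ adj u := by rw [hl]; simp
    refine .while_true (T₁ := 7 + K) (T₂ := l.length * (K + 11) + 4)
      (R := fun σ' => (∃ q', (q' = q ∨ q' = q ++ [v]) ∧ Inv q' (insert (u, v) D) σ' ∧
        HasQueue q' σ') ∧ σ'.arr 0 = A₀ ∧ σ'.arr 1 = A₁ ∧ σ'.reg 3 = h ∧
        σ'.reg 5 = u ∧ σ'.reg 6 = A₀ u + (pre ++ [v]).length ∧ σ'.reg 7 = A₀ u + (adj u).length) ?_ ?_
      (.seq (T₁ := 7) (R := fun τ => τ = (σ.setReg 8 v).setReg 6 (A₀ u + pre.length + 1)) ?_ ?_)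
      ?_ ?_
    · simp only [Expr.Fits, h6, h7]; omega
    · simp [Expr.val, h6, h7]; omega
    · refine (Runs.of_wp ?_).mono (Q := fun τ => τ = (σ.setReg 8 v).setReg 6 (A₀ u + pre.length + 1))
        (by simp [Cmd.cost, Expr.cost]) (fun _ h => h)
      have := v.isLt
      simp [Cmd.wp, Expr.Fits, Expr.val, State.setReg, h6, h1, harc]
      omega
    · rintro τ rfl
      refine (hb.runs q D _ u v (hb.congr _ _ σ _ ?_ ?_ hI) (hq.congr ?_ ?_) hu hv
        (hD v (by simp)) ?_ ?_).mono le_rfl ?_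
      · simp [State.setReg]
      · simp [State.setReg]
      · simp [State.setReg]
      · simp [State.setReg]
      · simp [State.setReg, h5]
      · simp [State.setReg]
      · rintro σ' ⟨hq', h0', h1', h3', h5', h6', h7'⟩
        simp [State.setReg] at h0' h1' h3' h5' h6' h7'
        exact ⟨hq', by rw [h0', h0], by rw [h1', h1], by rw [h3', h3], by rw [h5', h5],
          by rw [h6']; simp [Nat.add_assoc], by rw [h7', h7]⟩
    · rintro σ' ⟨⟨q', hq', hI', hQ'⟩, h0', h1', h3', h5', h6', h7'⟩
      have hvl : v ∉ l := by
        rw [hl] at hnd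
        exact (List.nodup_cons.1 (List.nodup_append.1 hnd).2.1).1
      refine (ih (pre ++ [v]) q' _ σ' (by simp [hl]) hI' hQ' ?_ ?_ h0' h1' h3' h5' h6' h7').mono
        le_rfl ?_
      · rcases hq' with rfl | rfl <;> simp [hu]
      · intro x hx hx'
        rcases hx' with e | e
        · simp at e; subst e; exact hvl hx
        · exact hD x (by simp [hx]) e
      · rintro σ'' ⟨⟨ext, he, hI'', hQ''⟩, hr⟩
        have hset : insert (u, v) D ∪ {e : Fin n × Fin n | e.1 = u ∧ e.2 ∈ l} =
            D ∪ {e | e.1 = u ∧ e.2 ∈ v :: l} := by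
          ext ⟨a, b⟩
          simp only [Set.mem_union, Set.mem_insert_iff, Prod.mk.injEq, Set.mem_ofPred_eq,
            List.mem_cons]
          tauto
        rw [hset] at hI''
        rcases hq' with rfl | rfl
        · exact ⟨⟨ext, by simp; omega, hI'', hQ''⟩, hr⟩
        · exact ⟨⟨v :: ext, by simp; omega, by simpa using hI'', by simpa using hQ''⟩, hr⟩
    · simp [Expr.cost]; ring_nf; omega

theorem HasAdjacency.sum_le (hA : HasAdjacency adj m A₀ A₁) {q : List (Fin n)} (hq : q.Nodup) :
    (q.map fun u => (adj u).length).sum ≤ m := by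
  rw [← hA.sum, ← List.sum_toFinset _ hq]
  exact Finset.sum_le_sum_of_subset (Finset.subset_univ _)

theorem ArcSpec.runs_explore (hb : ArcSpec W adj body K Inv) (hA : HasAdjacency adj m A₀ A₁)
    (hW : n + m + 1 ≤ W) (hnd : ∀ u, (adj u).Nodup) {s : Fin n} {σ : State}
    (hI : Inv [s] ∅ σ) (hQ : HasQueue [s] σ) (h0 : σ.arr 0 = A₀) (h1 : σ.arr 1 = A₁)
    (h3 : σ.reg 3 = 0) :
    Runs W (exploreCmd body) σ ((K + 40) * (m + 1)) (fun σ' =>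
      (∃ q, Inv q (arcsFrom adj q) σ') ∧ σ'.arr 0 = A₀ ∧ σ'.arr 1 = A₁) := by
  -- `pre` has been popped and `post` is waiting. A waiting vertex holds credit 24 for its test, its
  -- removal and the end of its scan (4 + 15 + 4). An unscanned arc holds `K + 36`: `K + 11` for its
  -- treatment and 24 for the vertex it may queue.
  refine (Runs.while_potential (W := W) (fun σ k => ∃ pre post,
    Inv (pre ++ post) (arcsFrom adj pre) σ ∧ HasQueue (pre ++ post) σ ∧ σ.reg 3 = pre.length ∧
    σ.arr 0 = A₀ ∧ σ.arr 1 = A₁ ∧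
    k = 4 + 24 * post.length + (K + 36) * (m - (pre.map fun u => (adj u).length).sum))
    ?_ ?_ ?_ (4 + 24 + (K + 36) * m) σ ?_).mono ?_ (fun _ h => h)
  · rintro σ k ⟨pre, post, hI, hQ, h3, -, -, -⟩
    have := (hb.nodup _ _ _ hI).length_le_card
    simp at this
    have h4 := hQ.1
    simp at h4
    simp only [Expr.Fits, h3, h4]
    omega
  · rintro σ k ⟨pre, post, hI, hQ, h3, h0, h1, hk⟩ hne
    have h4 := hQ.1
    simp at h4
    cases post with
    | nil => simp [Expr.val, h3, h4] at hne
    | cons u post =>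
      have hndq := hb.nodup _ _ _ hI
      have hcard := hndq.length_le_card
      simp at hcard
      have hu2 : σ.arr 2 pre.length = u := by
        rw [hQ.2 pre.length (by simp)]; simp
      have hle := hA.le u
      have hnx := hA.next u
      -- The out-degrees of distinct vertices sum to at most `m`, so the truncated difference in the
      -- potential is a true difference.
      have hsum := hA.sum_le (q := pre ++ [u]) (by
        rw [show pre ++ u :: post = (pre ++ [u]) ++ post by simp] at hndq
        exact (List.nodup_append.1 hndq).1)
      simp at hsum
      refine ⟨15 + ((adj u).length * (K + 11) + 4), 4 + 24 * (post.length + (adj u).length) +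
          (K + 36) * (m - ((pre ++ [u]).map fun u => (adj u).length).sum), ?_, .seq (T₁ := 15)
        (R := fun τ => τ = (((σ.setReg 5 u).setReg 3 (pre.length + 1)).setReg 6 (A₀ u)).setReg 7
          (A₀ u + (adj u).length)) ?_ ?_⟩
      · obtain ⟨r, hr⟩ : ∃ r, m = (pre.map fun u => (adj u).length).sum + (adj u).length + r :=
          ⟨_, (Nat.add_sub_cancel' hsum).symm⟩
        have e1 : m - (pre.map fun u => (adj u).length).sum = (adj u).length + r := by omega
        have e2 : m - ((pre ++ [u]).map fun u => (adj u).length).sum = r := by simp; omega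
        rw [hk, e1, e2]
        simp [Expr.cost]
        ring_nf; omega
      · refine (Runs.of_wp ?_).mono (Q := fun τ => τ = (((σ.setReg 5 u).setReg 3
          (pre.length + 1)).setReg 6 (A₀ u)).setReg 7 (A₀ u + (adj u).length))
          (by simp [popCmd, Cmd.cost, Expr.cost]) (fun _ h => h)
        have := u.isLt
        simp [popCmd, Cmd.wp, Expr.Fits, Expr.val, State.setReg, h3, h0, hu2, hnx]
        omega
      · rintro τ rfl
        refine (hb.runs_scan hA hW (pre.length + 1) u (hnd u) (adj u) [] (pre ++ u :: post)
          (arcsFrom adj pre) _ rfl (hb.congr _ _ σ _ ?_ ?_ hI) (hQ.congr ?_ ?_) (by simp) ?_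
          ?_ ?_ ?_ ?_ ?_ ?_).mono le_rfl ?_
        any_goals simp [State.setReg, h0, h1]
        · intro x _ hx
          have hx1 : u ∈ pre := hx.1
          exact (List.nodup_append.1 hndq).2.2 u hx1 u (by simp) rfl
        · intro σ' ext he hI' hQ' h0' h1' h3'
          refine ⟨pre ++ [u], post ++ ext, ?_, ?_, ?_, ?_, h0', h1'⟩
          · simp; omega
          · have : arcsFrom adj (pre ++ [u]) =
              arcsFrom adj pre ∪ {e | e.1 = u ∧ e.2 ∈ adj u} := by
              ext ⟨a, b⟩
              simp only [arcsFrom, List.mem_append, List.mem_singleton, Set.mem_ofPred_eq,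
                Set.mem_union]
              constructor
              · rintro ⟨h | rfl, h'⟩
                · exact .inl ⟨h, h'⟩
                · exact .inr ⟨rfl, h'⟩
              · rintro (h | ⟨rfl, h⟩)
                · exact ⟨.inl h.1, h.2⟩
                · exact ⟨.inr rfl, h⟩
            rw [this]
            simpa using hI'
          · simpa using hQ'
          · simpa using h3'
  · rintro σ k ⟨pre, post, hI, hQ, h3, h0, h1, hk⟩ he
    have h4 := hQ.1
    simp at h4
    have : post = [] := by
      simp [Expr.val, h3, h4] at he
      exact he
    subst this
    refine ⟨by simp [Expr.cost]; omega, ⟨pre, by simpa using hI⟩, h0, h1⟩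
  · exact ⟨[], [s], by simpa [arcsFrom] using hI, by simpa using hQ, by simpa using h3, h0, h1,
      by simp⟩
  · ring_nf; omega

end Explore

/-! ### First traversal: counting the arcs from descendants -/

section CountIndegrees

variable {n : ℕ} {G : Digraph (Fin n)} {adj : Fin n → List (Fin n)} {s : Fin n}

/-- The treatment of an arc in the first pass: count it, and queue its head when it is new. -/
def countCmd : Cmd :=
  .seq (.ite (.eq (.get 3 (.reg 8)) (.lit 0))
    (.seq (.store 2 (.reg 4) (.reg 8)) (.assign 4 (.add (.reg 4) (.lit 1)))) .skip)
    (.store 3 (.reg 8) (.add (.get 3 (.reg 8)) (.lit 1)))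

/-- The invariant of the first pass: array `3` counts the treated arcs into each vertex. -/
structure CountInv (G : Digraph (Fin n)) (s : Fin n) (q : List (Fin n))
    (D : Set (Fin n × Fin n)) (σ : State) : Prop where
  nodup : q.Nodup
  desc : ∀ v ∈ q, IsDescendant G s v
  mem : ∀ v, v ∈ q ↔ v = s ∨ ∃ w, (w, v) ∈ D
  count : ∀ v : Fin n, σ.arr 3 v = {w | (w, v) ∈ D}.ncard
  zero : ∀ a, 4 ≤ a → ∀ i, σ.arr a i = 0
  source : σ.reg 2 = s

theorem IsDAG.ne_source (hG : IsDAG G) {u v : Fin n} (hu : IsDescendant G s u)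
    (huv : G.Adj u v) : v ≠ s := by
  rintro rfl
  exact hG v (Relation.TransGen.tail' hu huv)

theorem ncard_le_card (S : Set (Fin n)) : S.ncard ≤ n := by
  simpa using Set.ncard_le_card S

theorem ncard_preimage_insert {D : Set (Fin n × Fin n)} {u v : Fin n} (hD : (u, v) ∉ D)
    (x : Fin n) : {w | (w, x) ∈ insert (u, v) D}.ncard =
      {w | (w, x) ∈ D}.ncard + if x = v then 1 else 0 := by
  split_ifs with h
  · subst h
    rw [← Set.ncard_insert_of_notMem (a := u) (s := {w | (w, x) ∈ D}) hD (Set.toFinite _)]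
    congr 1
    ext w
    simp
  · simp [h]

theorem length_lt_of_notMem {q : List (Fin n)} {v : Fin n} (hq : q.Nodup) (hv : v ∉ q) :
    q.length < n := by
  have := (List.nodup_cons.2 ⟨hv, hq⟩).length_le_card
  simpa using this

theorem HasQueue.concat {q : List (Fin n)} {v : Fin n} {σ σ' : State} (h : HasQueue q σ)
    (h4 : σ'.reg 4 = q.length + 1)
    (ha : σ'.arr 2 = Function.update (σ.arr 2) q.length v) : HasQueue (q ++ [v]) σ' := by
  refine ⟨by simp [h4], fun i hi => ?_⟩
  simp at hi
  rw [ha]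
  rcases hi.lt_or_eq with h' | h'
  · rw [Function.update_of_ne h'.ne, h.2 i h', List.getElem_append_left]
  · subst h'; simp

/-- The counter doubles as the mark of visited vertices: a head has count zero exactly when it is
not yet queued. The only queued vertex without a counted arc is $s$, which by acyclicity is never a
head. -/
theorem CountInv.arcSpec (hG : IsDAG G) (hadj : IsAdjacencyList G adj) {W m : ℕ}
    (hW : n + m + 1 ≤ W) : ArcSpec W adj countCmd 30 (CountInv G s) where
  nodup _ _ _ h := h.nodup
  congr q D σ σ' h2 ha h := ⟨h.nodup, h.desc, h.mem, ha ▸ h.count, ha ▸ h.zero, h2 ▸ h.source⟩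
  runs q D σ u v hI hQ hu hv hD h5 h8 := by
    rw [hadj.mem_iff] at hv
    have hvs := hG.ne_source (hI.desc u hu) hv
    have hdv : IsDescendant G s v := Relation.ReflTransGen.tail (hI.desc u hu) hv
    have hvn := v.isLt
    have hc := hI.count v
    have hcn := ncard_le_card {w | (w, v) ∈ D}
    have hmem' : ∀ x, (x = s ∨ ∃ w, (w, x) ∈ insert (u, v) D) ↔ x ∈ q ∨ x = v := by
      intro x
      rw [hI.mem]
      simp only [Set.mem_insert_iff, Prod.mk.injEq]
      constructor
      · rintro (h | ⟨w, h | h⟩)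
        · exact .inl (.inl h)
        · exact .inr h.2
        · exact .inl (.inr ⟨w, h⟩)
      · rintro ((h | ⟨w, h⟩) | h)
        · exact .inl h
        · exact .inr ⟨w, .inr h⟩
        · exact .inr ⟨u, .inl ⟨rfl, h⟩⟩
    have hcount : ∀ (f : ℕ → ℕ), f = Function.update (σ.arr 3) v (σ.arr 3 v + 1) →
        ∀ x : Fin n, f x = {w | (w, x) ∈ insert (u, v) D}.ncard := by
      rintro f rfl x
      rw [ncard_preimage_insert hD, ← hI.count]
      by_cases h : x = v
      · subst h; simp
      · simp [h, Fin.val_inj]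
    have hv0 : σ.arr 3 v = 0 ↔ v ∉ q := by
      rw [hc, Set.ncard_eq_zero (Set.toFinite _), hI.mem]
      simp [hvs, Set.eq_empty_iff_forall_notMem]
    by_cases hvq : v ∈ q
    · have h0 : σ.arr 3 v ≠ 0 := fun h => hv0.1 h hvq
      refine (Runs.of_wp (Q := fun τ => τ = σ.setCell 3 v (σ.arr 3 v + 1)) ?_).mono
        (by simp [countCmd, Cmd.cost, Expr.cost]) ?_
      · simp [countCmd, Cmd.wp, Expr.Fits, Expr.val, h8, h0]
        omega
      · rintro τ rfl
        refine ⟨⟨q, .inl rfl, ⟨hI.nodup, hI.desc, ?_, hcount _ ?_, ?_, ?_⟩, hQ.congr ?_ ?_⟩, ?_⟩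
        · intro x
          rw [hmem']
          exact ⟨.inl, fun h => h.elim id (fun e => e ▸ hvq)⟩
        any_goals simp [State.setCell]
        · intro a ha i
          rw [Function.update_of_ne (by omega), hI.zero a ha]
        · exact hI.source
    · have h0 : σ.arr 3 v = 0 := hv0.2 hvq
      have hlt := length_lt_of_notMem hI.nodup hvq
      have h4 := hQ.1
      refine (Runs.of_wp (Q := fun τ => τ = (((σ.setCell 2 q.length v).setReg 4
        (q.length + 1)).setCell 3 v (σ.arr 3 v + 1))) ?_).mono
        (by simp [countCmd, Cmd.cost, Expr.cost]) ?_
      · simp [countCmd, Cmd.wp, Expr.Fits, Expr.val, State.setReg, State.setCell, h8, h0, h4]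
        omega
      · rintro τ rfl
        refine ⟨⟨q ++ [v], .inr rfl, ⟨?_, ?_, ?_, hcount _ ?_, ?_, ?_⟩, hQ.concat ?_ ?_⟩, ?_⟩
        · simpa using List.Nodup.concat hvq hI.nodup
        · intro x hx
          rcases List.mem_append.1 hx with h | h
          · exact hI.desc x h
          · simp at h; exact h ▸ hdv
        · intro x
          rw [hmem']
          simp
        any_goals simp [State.setCell, State.setReg]
        · intro a ha i
          rw [Function.update_of_ne (by omega), Function.update_of_ne (by omega), hI.zero a ha]
        · exact hI.source

/-- Once all arcs out of the queue have been treated, the queue is closed under out-neighbours. -/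
theorem CountInv.mem_iff (hadj : IsAdjacencyList G adj) {q : List (Fin n)} {σ : State}
    (h : CountInv G s q (arcsFrom adj q) σ) (v : Fin n) : v ∈ q ↔ IsDescendant G s v := by
  refine ⟨h.desc v, fun hv => ?_⟩
  induction hv with
  | refl => exact (h.mem s).2 (.inl rfl)
  | tail _ hwv ih => exact (h.mem _).2 (.inr ⟨_, ih, (hadj.mem_iff _ _).2 hwv⟩)

/-- The numbers of arcs into each vertex from descendants of `s` that are not in `D`. -/
noncomputable def openCount (G : Digraph (Fin n)) (s : Fin n) (D : Set (Fin n × Fin n))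
    (v : Fin n) : ℕ :=
  {w | IsDescendant G s w ∧ G.Adj w v ∧ (w, v) ∉ D}.ncard

/-- The handover between the traversals: the final counts of the first are the initial counts of
untreated arcs of the second. -/
theorem CountInv.count_eq (hadj : IsAdjacencyList G adj) {q : List (Fin n)} {σ : State}
    (h : CountInv G s q (arcsFrom adj q) σ) (v : Fin n) : σ.arr 3 v = openCount G s ∅ v := by
  rw [h.count, openCount]
  congr 1
  ext w
  simp [arcsFrom, h.mem_iff hadj, hadj.mem_iff]

theorem openCount_insert {D : Set (Fin n × Fin n)} {u v : Fin n} (hD : (u, v) ∉ D)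
    (hu : IsDescendant G s u) (huv : G.Adj u v) (x : Fin n) :
    openCount G s (insert (u, v) D) x = openCount G s D x - if x = v then 1 else 0 := by
  split_ifs with h
  · subst h
    rw [openCount, openCount, ← Set.ncard_sdiff_singleton_of_mem
      (show u ∈ {w | IsDescendant G s w ∧ G.Adj w x ∧ (w, x) ∉ D} from ⟨hu, huv, hD⟩)]
    congr 1
    ext w
    simp
    tauto
  · simp [openCount, h]

end CountIndegrees

/-! ### Circular linked lists -/

theorem List.IsChain.imp_concat {α : Type*} {R S : α → α → Prop} {A : List α} {a : α}
    (h : (A ++ [a]).IsChain R) (H : ∀ x ∈ A, ∀ y, R x y → S x y) : (A ++ [a]).IsChain S := by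
  induction A with
  | nil => simp
  | cons b A ih =>
    rw [List.cons_append, List.isChain_cons] at h ⊢
    exact ⟨fun y hy => H b (by simp) y (h.1 y hy), ih h.2 fun x hx => H x (by simp [hx])⟩

section Ring

variable {α : Type*} [DecidableEq α]

/-- `l` is the circular list that starts at `s` and is linked by `next`. -/
structure IsRing (s : α) (next : α → α) (l : List α) : Prop where
  head : l.head? = some s
  nodup : l.Nodup
  chain : (l ++ [s]).IsChain (fun a b => next a = b)

/-- Only the links of `a` and `v` change, so the links within `A` and `B` survive; `v` inherits the
old successor of `a`, which may be $s$ when `B` is empty. -/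
theorem IsRing.insert {s : α} {next : α → α} {A B : List α} {a v : α}
    (h : IsRing s next (A ++ a :: B)) (hv : v ∉ A ++ a :: B) :
    IsRing s (Function.update (Function.update next v (next a)) a v) (A ++ a :: v :: B) := by
  have hnd := h.nodup
  have hva : v ≠ a := by rintro rfl; simp at hv
  have hvA : v ∉ A := fun h => hv (by simp [h])
  have hvB : v ∉ B := fun h => hv (by simp [h])
  have haA : a ∉ A := fun h => (List.nodup_append.1 hnd).2.2 a h a (by simp) rfl
  have haB : a ∉ B := (List.nodup_cons.1 (List.nodup_append.1 hnd).2.1).1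
  have H : ∀ L : List α, v ∉ L → a ∉ L → ∀ x ∈ L, ∀ y, next x = y →
      Function.update (Function.update next v (next a)) a v x = y := by
    intro L hvL haL x hx y hxy
    rw [Function.update_of_ne (ne_of_mem_of_not_mem hx haL), Function.update_of_ne (ne_of_mem_of_not_mem hx hvL),
      hxy]
  have hc := h.chain
  rw [List.append_assoc, List.cons_append, List.isChain_split, List.isChain_cons] at hc
  refine ⟨?_, ?_, ?_⟩
  · have := h.head
    cases A <;> simpa using this
  · have : (A ++ a :: v :: B).Perm (v :: (A ++ a :: B)) := by
      rw [show A ++ a :: v :: B = (A ++ [a]) ++ v :: B by simp,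
        show A ++ a :: B = (A ++ [a]) ++ B by simp]
      exact List.perm_middle
    exact this.nodup_iff.2 (List.nodup_cons.2 ⟨hv, hnd⟩)
  · rw [List.append_assoc, List.cons_append, List.isChain_split, List.cons_append,
      List.isChain_cons, List.isChain_cons]
    refine ⟨hc.1.imp_concat (H A hvA haA), ?_, ?_, hc.2.2.imp_concat (H B hvB haB)⟩
    · intro y hy; simpa using hy
    · intro y hy
      rw [Function.update_of_ne hva, Function.update_self]
      exact hc.2.1 y hy

end Ring

/-! ### Second traversal: invariant of labels and ring -/

section Label

variable {n : ℕ} {G : Digraph (Fin n)} {s : Fin n}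

/-- The invariant of the second pass, which queues a vertex as soon as all arcs that enter it from
descendants of `s` are in the set `D` of treated arcs: `p` labels the queued vertices (and, so far
as known, the others), and `next` links the queued vertices to a ring in which vertices with the
same label are consecutive and their label comes first. -/
structure LabelInv (G : Digraph (Fin n)) (s : Fin n) (q : List (Fin n)) (D : Set (Fin n × Fin n))
    (p next : Fin n → Fin n) : Prop where
  nodup : q.Nodup
  desc : ∀ v ∈ q, IsDescendant G s v
  tail : ∀ w v, (w, v) ∈ D → w ∈ q ∧ G.Adj w v
  mem : ∀ v, v ∈ q ↔ v = s ∨ ((∃ w, (w, v) ∈ D) ∧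
    ∀ w, IsDescendant G s w → G.Adj w v → (w, v) ∈ D)
  source : p s = s
  ne_source : ∀ v ∈ q, v ≠ s → p v ≠ s
  label_mem : ∀ v ∈ q, p v ∈ q
  label_label : ∀ v ∈ q, p (p v) = p v
  label : ∀ v ∈ q, v ≠ s → (∀ w, (w, v) ∈ D → p w = p v) ∨
    (p v = v ∧ ∀ c, c ≠ s → ∃ w, (w, v) ∈ D ∧ p w ≠ c)
  tentative : ∀ v ∉ q, (∃ w, (w, v) ∈ D) → (∀ w, (w, v) ∈ D → p w = p v) ∨
    (p v = v ∧ ∀ c, ∃ w, (w, v) ∈ D ∧ p w ≠ c)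
  ring : ∃ l, l.Perm q ∧ IsRing s next l ∧ l.IsChain (fun a b => p b = b ∨ p a = p b)

open Classical in
/-- The labelling after the arc from `u` to `v` has been treated. -/
noncomputable def relabel (D : Set (Fin n × Fin n)) (p : Fin n → Fin n) (u v : Fin n) :
    Fin n → Fin n :=
  Function.update p v (if ∃ w, (w, v) ∈ D then (if p v = p u then p v else v) else p u)

/-- The final label of `v`, if all arcs that enter `v` have been treated. -/
def finalLabel (s : Fin n) (p : Fin n → Fin n) (v : Fin n) : Fin n → Fin n :=
  Function.update p v (if p v = s then v else p v)

/-- The queued vertex after which `v` enters the ring. -/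
def ringPred (s : Fin n) (p : Fin n → Fin n) (v : Fin n) : Fin n :=
  if p v = v then s else p v

theorem relabel_of_ne {D : Set (Fin n × Fin n)} {p : Fin n → Fin n} {u v x : Fin n} (h : x ≠ v) :
    relabel D p u v x = p x := Function.update_of_ne h _ _

theorem finalLabel_of_ne {p : Fin n → Fin n} {v x : Fin n} (h : x ≠ v) :
    finalLabel s p v x = p x := Function.update_of_ne h _ _

variable {q : List (Fin n)} {D : Set (Fin n × Fin n)} {p next : Fin n → Fin n} {u v : Fin n}

theorem LabelInv.source_mem (h : LabelInv G s q D p next) : s ∈ q := (h.mem s).2 (.inl rfl)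

/-- The head of an untreated arc cannot be queued yet: queueing waits for all its arcs from
descendants, and $s$ has none. -/
theorem LabelInv.notMem (h : LabelInv G s q D p next) (hG : IsDAG G) (hu : u ∈ q)
    (huv : G.Adj u v) (hD : (u, v) ∉ D) : v ∉ q := by
  intro hv
  rcases (h.mem v).1 hv with e | h'
  · exact hG.ne_source (h.desc u hu) huv e
  · exact hD (h'.2 u (h.desc u hu) huv)

/-- Before `v` is queued, its tentative label is the common label of the tails seen so far, possibly
$s$, or `v` itself once two of them differ. The two cases cannot be confused, since labels of queued
vertices are queued and `v` is not. -/
theorem LabelInv.relabel_tentative (h : LabelInv G s q D p next) (hu : u ∈ q) (hv : v ∉ q) :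
    (∀ w, (w, v) ∈ insert (u, v) D → relabel D p u v w = relabel D p u v v) ∨
    (relabel D p u v v = v ∧ ∀ c, ∃ w, (w, v) ∈ insert (u, v) D ∧ relabel D p u v w ≠ c) := by
  have hne : ∀ x ∈ q, x ≠ v := fun x hx e => hv (e ▸ hx)
  have hold : ∀ w, (w, v) ∈ D → relabel D p u v w = p w :=
    fun w hw => relabel_of_ne (hne w (h.tail w v hw).1)
  have hnew : relabel D p u v u = p u := relabel_of_ne (hne u hu)
  have hval : relabel D p u v v = _ := Function.update_self ..
  by_cases hw : ∃ w, (w, v) ∈ D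
  · rw [if_pos hw] at hval
    rcases h.tentative v hv hw with h1 | ⟨h1, h2⟩
    · by_cases e : p v = p u
      · left
        rw [if_pos e] at hval
        rintro w (hw' | hw')
        · simp at hw'
          rw [hw', hnew, hval, e]
        · rw [hold w hw', hval, h1 w hw']
      · right
        rw [if_neg e] at hval
        refine ⟨hval, fun c => ?_⟩
        obtain ⟨w, hw⟩ := hw
        -- The old tails all have the label `p v`, and `p u` is different, so an old tail or `u`
        -- avoids `c`.
        by_cases hc : p u = c
        · exact ⟨w, .inr hw, by rw [hold w hw, h1 w hw, ← hc]; exact e⟩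
        · exact ⟨u, .inl rfl, by rw [hnew]; exact hc⟩
    · right
      refine ⟨by rw [hval]; split_ifs <;> simp [h1], fun c => ?_⟩
      obtain ⟨w, hw, hwc⟩ := h2 c
      exact ⟨w, .inr hw, by rwa [hold w hw]⟩
  · left
    rw [if_neg hw] at hval
    rintro w (hw' | hw')
    · simp at hw'
      rw [hw', hnew, hval]
    · exact (hw ⟨w, hw'⟩).elim

/-- Some arc into `v` is still open, so `v` stays out of the queue; only its tentative label
changes, and all facts about queued vertices persist because tails of treated arcs are queued. -/
theorem LabelInv.visit (h : LabelInv G s q D p next) (hG : IsDAG G) (hu : u ∈ q)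
    (huv : G.Adj u v) (hD : (u, v) ∉ D)
    (hopen : ∃ w, IsDescendant G s w ∧ G.Adj w v ∧ (w, v) ∉ insert (u, v) D) :
    LabelInv G s q (insert (u, v) D) (relabel D p u v) next := by
  have hv := h.notMem hG hu huv hD
  have hvs : v ≠ s := hG.ne_source (h.desc u hu) huv
  have hne : ∀ x ∈ q, x ≠ v := fun x hx e => hv (e ▸ hx)
  have hp : ∀ x ∈ q, relabel D p u v x = p x := fun x hx => relabel_of_ne (hne x hx)
  have hins : ∀ x, x ≠ v → ∀ w, (w, x) ∈ insert (u, v) D ↔ (w, x) ∈ D := by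
    intro x hx w; simp [hx]
  refine ⟨h.nodup, h.desc, ?_, ?_, ?_, ?_, ?_, ?_, ?_, ?_, ?_⟩
  · rintro w x (e | hw)
    · simp at e; rw [e.1, e.2]; exact ⟨hu, huv⟩
    · exact h.tail w x hw
  · intro x
    by_cases hx : x = v
    · subst hx
      simp only [hv, hvs, false_or, false_iff, not_and, not_forall]
      obtain ⟨w, h1, h2, h3⟩ := hopen
      exact fun _ => ⟨w, h1, h2, h3⟩
    · simp only [hins x hx]
      exact h.mem x
  · rw [hp s h.source_mem, h.source]
  · intro x hx; rw [hp x hx]; exact h.ne_source x hx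
  · intro x hx; rw [hp x hx]; exact h.label_mem x hx
  · intro x hx; rw [hp x hx, hp _ (h.label_mem x hx)]; exact h.label_label x hx
  · intro x hx hxs
    simp only [hins x (hne x hx), hp x hx]
    rcases h.label x hx hxs with h1 | ⟨h1, h2⟩
    · exact .inl fun w hw => by rw [hp w (h.tail w x hw).1, h1 w hw]
    · refine .inr ⟨h1, fun c hc => ?_⟩
      obtain ⟨w, hw, hwc⟩ := h2 c hc
      exact ⟨w, hw, by rwa [hp w (h.tail w x hw).1]⟩
  · intro x hx
    by_cases hxv : x = v
    · subst hxv
      exact fun _ => h.relabel_tentative hu hv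
    · simp only [hins x hxv, relabel_of_ne hxv]
      intro hw
      rcases h.tentative x hx hw with h1 | ⟨h1, h2⟩
      · exact .inl fun w hw => by rw [hp w (h.tail w x hw).1, h1 w hw]
      · refine .inr ⟨h1, fun c => ?_⟩
        obtain ⟨w, hw, hwc⟩ := h2 c
        exact ⟨w, hw, by rwa [hp w (h.tail w x hw).1]⟩
  · obtain ⟨l, hl, hr, hc⟩ := h.ring
    refine ⟨l, hl, hr, hc.imp_of_mem_imp ?_⟩
    intro a b ha hb
    rw [hp a (hl.mem_iff.1 ha), hp b (hl.mem_iff.1 hb)]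
    exact id

/-- The last arc into `v` has been treated. A tentative label $s$ is replaced by `v`, and `v` enters
the ring directly behind its label, or behind $s$ if it founds a new set. -/
theorem LabelInv.push (h : LabelInv G s q D p next) (hG : IsDAG G) (hu : u ∈ q)
    (huv : G.Adj u v) (hD : (u, v) ∉ D)
    (hclosed : ∀ w, IsDescendant G s w → G.Adj w v → (w, v) ∈ insert (u, v) D) :
    LabelInv G s (q ++ [v]) (insert (u, v) D) (finalLabel s (relabel D p u v) v)
      (Function.update (Function.update next v
        (next (ringPred s (finalLabel s (relabel D p u v) v) v)))
        (ringPred s (finalLabel s (relabel D p u v) v) v) v) ∧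
      ringPred s (finalLabel s (relabel D p u v) v) v ∈ q := by
  have hv := h.notMem hG hu huv hD
  have hvs : v ≠ s := hG.ne_source (h.desc u hu) huv
  have hne : ∀ x ∈ q, x ≠ v := fun x hx e => hv (e ▸ hx)
  have hins : ∀ x, x ≠ v → ∀ w, (w, x) ∈ insert (u, v) D ↔ (w, x) ∈ D := by
    intro x hx w; simp [hx]
  have htail : ∀ w x, (w, x) ∈ insert (u, v) D → w ∈ q ∧ G.Adj w x := by
    rintro w x (e | hw)
    · simp at e; rw [e.1, e.2]; exact ⟨hu, huv⟩
    · exact h.tail w x hw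
  obtain ⟨p', hp'⟩ : ∃ p', p' = finalLabel s (relabel D p u v) v := ⟨_, rfl⟩
  have hp : ∀ x, x ≠ v → p' x = p x := by
    intro x hx; rw [hp', finalLabel_of_ne hx, relabel_of_ne hx]
  have hpq : ∀ x ∈ q, p' x = p x := fun x hx => hp x (hne x hx)
  have hpv : p' v = if relabel D p u v v = s then v else relabel D p u v v := by
    rw [hp']; exact Function.update_self ..
  have hrq : ∀ x ∈ q, relabel D p u v x = p x := fun x hx => relabel_of_ne (hne x hx)
  have hpvs : p' v ≠ s := by
    rw [hpv]; split_ifs with e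
    · exact hvs
    · exact e
  have hlab : (∀ w, (w, v) ∈ insert (u, v) D → p' w = p' v) ∨
      (p' v = v ∧ ∀ c, c ≠ s → ∃ w, (w, v) ∈ insert (u, v) D ∧ p' w ≠ c) := by
    rcases h.relabel_tentative hu hv with h1 | ⟨h1, h2⟩
    -- All tails have the label $s$, so none of them has a label `c` different from $s$, and `u`
    -- serves as witness.
    · by_cases e : relabel D p u v v = s
      · right
        refine ⟨by rw [hpv, if_pos e], fun c hc => ⟨u, .inl rfl, ?_⟩⟩
        have := h1 u (.inl rfl)
        rw [hpq u hu, ← hrq u hu, this, e]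
        exact hc.symm
      · left
        intro w hw
        have hwq := (htail w v hw).1
        rw [hpv, if_neg e, hpq w hwq, ← hrq w hwq, h1 w hw]
    · right
      refine ⟨by rw [hpv, h1]; simp, fun c _ => ?_⟩
      obtain ⟨w, hw, hwc⟩ := h2 c
      have hwq := (htail w v hw).1
      exact ⟨w, hw, by rwa [hpq w hwq, ← hrq w hwq]⟩
  have hor : p' v = v ∨ p' v = p u := by
    rcases hlab with h1 | h1
    · right; rw [← h1 u (.inl rfl), hpq u hu]
    · exact .inl h1.1
  have hpred : ringPred s p' v ∈ q := by
    rw [ringPred]; split_ifs with e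
    · exact h.source_mem
    · rw [hor.resolve_left e]; exact h.label_mem u hu
  rw [← hp']
  refine ⟨⟨?_, ?_, ?_, ?_, ?_, ?_, ?_, ?_, ?_, ?_, ?_⟩, hpred⟩
  · simpa using List.Nodup.concat hv h.nodup
  · intro x hx
    rcases List.mem_append.1 hx with hx | hx
    · exact h.desc x hx
    · simp at hx
      subst hx
      exact Relation.ReflTransGen.tail (h.desc u hu) huv
  · exact fun w x hw => ⟨List.mem_append_left _ (htail w x hw).1, (htail w x hw).2⟩
  · intro x
    by_cases hx : x = v
    · subst hx
      simp only [List.mem_append, List.mem_singleton, or_true, true_iff]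
      exact .inr ⟨⟨u, .inl rfl⟩, hclosed⟩
    · simp only [hins x hx, List.mem_append, List.mem_singleton, hx, or_false]
      exact h.mem x
  · rw [hpq s h.source_mem, h.source]
  · intro x hx hxs
    rcases List.mem_append.1 hx with hx | hx
    · rw [hpq x hx]; exact h.ne_source x hx hxs
    · simp at hx; rw [hx]; exact hpvs
  · intro x hx
    rcases List.mem_append.1 hx with hx | hx
    · rw [hpq x hx]; exact List.mem_append_left _ (h.label_mem x hx)
    · simp at hx; rw [hx]
      rcases hor with e | e <;> rw [e]
      · simp
      · exact List.mem_append_left _ (h.label_mem u hu)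
  · intro x hx
    rcases List.mem_append.1 hx with hx | hx
    · rw [hpq x hx, hpq _ (h.label_mem x hx)]; exact h.label_label x hx
    · simp at hx; rw [hx]
      rcases hor with e | e
      · rw [e, e]
      · rw [e, hpq _ (h.label_mem u hu)]; exact h.label_label u hu
  · intro x hx hxs
    rcases List.mem_append.1 hx with hx | hx
    · simp only [hins x (hne x hx), hpq x hx]
      rcases h.label x hx hxs with h1 | ⟨h1, h2⟩
      · exact .inl fun w hw => by rw [hpq w (h.tail w x hw).1, h1 w hw]
      · refine .inr ⟨h1, fun c hc => ?_⟩
        obtain ⟨w, hw, hwc⟩ := h2 c hc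
        exact ⟨w, hw, by rwa [hpq w (h.tail w x hw).1]⟩
    · simp at hx; rw [hx]; exact hlab
  · intro x hx
    have hxv : x ≠ v := fun e => hx (by simp [e])
    have hxq : x ∉ q := fun e => hx (by simp [e])
    simp only [hins x hxv, hp x hxv]
    intro hw
    rcases h.tentative x hxq hw with h1 | ⟨h1, h2⟩
    · exact .inl fun w hw => by rw [hpq w (h.tail w x hw).1, h1 w hw]
    · refine .inr ⟨h1, fun c => ?_⟩
      obtain ⟨w, hw, hwc⟩ := h2 c
      exact ⟨w, hw, by rwa [hpq w (h.tail w x hw).1]⟩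
  · obtain ⟨l, hl, hr, hc⟩ := h.ring
    obtain ⟨a, ha⟩ : ∃ a, a = ringPred s p' v := ⟨_, rfl⟩
    rw [← ha] at hpred ⊢
    obtain ⟨A, B, rfl⟩ := List.append_of_mem (hl.mem_iff.2 hpred)
    have hvl : v ∉ A ++ a :: B := fun e => hv (hl.mem_iff.1 e)
    have hc' : (A ++ a :: B).IsChain (fun a b => p' b = b ∨ p' a = p' b) := by
      refine hc.imp_of_mem_imp ?_
      intro x y hx hy
      rw [hpq x (hl.mem_iff.1 hx), hpq y (hl.mem_iff.1 hy)]
      exact id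
    refine ⟨A ++ a :: v :: B, ?_, hr.insert hvl, ?_⟩
    · rw [show A ++ a :: v :: B = (A ++ [a]) ++ v :: B by simp]
      refine List.perm_middle.trans ?_
      refine ((List.Perm.cons v ?_).trans (List.perm_append_singleton v q).symm)
      simpa using hl
    · rw [List.isChain_split, List.isChain_cons] at hc' ⊢
      rw [List.isChain_cons]
      -- The insertion point is its own label, hence the first vertex of its set; insertion right
      -- behind it keeps the label in front.
      have hpa : p' a = a := by
        rw [ha, ringPred]; split_ifs with e
        · rw [hpq s h.source_mem, h.source]
        · rw [hor.resolve_left e, hpq _ (h.label_mem u hu), h.label_label u hu]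
      refine ⟨hc'.1, ?_, ?_, hc'.2.2⟩
      · intro y hy
        simp at hy
        subst hy
        by_cases e : p' v = v
        · exact .inl e
        · right
          rw [hpa, ha, ringPred, if_neg e]
      · intro y hy
        have hyB : y ∈ B := List.mem_of_mem_head? hy
        have hyq : y ∈ q := hl.mem_iff.1 (by simp [hyB])
        rcases hc'.2.1 y hy with e | e
        · exact .inl e
        -- The set of $s$ is a singleton, so the old successor of $s$ starts a set and insertion
        -- behind $s$ splits none. If the insertion point is not $s$, then `v` joins the set of that
        -- point, to which `y` belongs as well.
        by_cases hs : a = s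
        · exfalso
          rw [hpa, hs, hpq y hyq] at e
          have hys : y ≠ s := by
            rintro rfl
            have := (List.nodup_cons.1 (List.nodup_append.1 hr.nodup).2.1).1
            rw [hs] at this
            exact this hyB
          exact h.ne_source y hyq hys e.symm
        · right
          by_cases e' : p' v = v
          · exact (hs (ha.trans (by simp [ringPred, e']))).elim
          · rw [← e, hpa, ha, ringPred, if_neg e']

/-- No descendant is left waiting: by induction on the number of ancestors, all its predecessors
among the descendants are queued, so all its arcs from them have been treated. Acyclicity is what
makes this induction possible. -/
theorem LabelInv.mem_iff (h : LabelInv G s q D p next) (hG : IsDAG G)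
    (hD : ∀ w v, w ∈ q → G.Adj w v → (w, v) ∈ D) (v : Fin n) : v ∈ q ↔ IsDescendant G s v := by
  refine ⟨h.desc v, ?_⟩
  induction hk : ancestorCount G v using Nat.strong_induction_on generalizing v with
  | _ k ih =>
    intro hv
    have key : ∀ w, IsDescendant G s w → G.Adj w v → (w, v) ∈ D := fun w hw hwv =>
      hD w v (ih _ (hk ▸ hG.ancestorCount_lt (.single hwv)) w rfl hw) hwv
    rcases Relation.ReflTransGen.cases_tail hv with e | ⟨w, hw, hwv⟩
    · exact (h.mem v).2 (.inl e)
    · exact (h.mem v).2 (.inr ⟨⟨w, key w hw hwv⟩, key⟩)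

theorem LabelInv.isLabelling (h : LabelInv G s q D p next) (hG : IsDAG G)
    (hD : ∀ w v, w ∈ q → G.Adj w v → (w, v) ∈ D) : IsLabelling G s p := by
  have hq := h.mem_iff hG hD
  refine ⟨h.source, fun v hv => h.ne_source v ((hq v).2 hv), fun v hv hvs => ?_⟩
  rcases h.label v ((hq v).2 hv) hvs with h1 | ⟨h1, h2⟩
  · exact .inl fun w hw hwv => h1 w (hD w v ((hq w).2 hw) hwv)
  · refine .inr ⟨h1, fun c hc => ?_⟩
    obtain ⟨w, hw, hwc⟩ := h2 c hc
    exact ⟨w, h.desc w (h.tail w v hw).1, (h.tail w v hw).2, hwc⟩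

/-- Only the values at $s$ matter, since nothing else is queued and no arc has been treated. -/
theorem LabelInv.init (G : Digraph (Fin n)) {s : Fin n} {p next : Fin n → Fin n} (hp : p s = s)
    (hn : next s = s) : LabelInv G s [s] ∅ p next := by
  refine ⟨by simp, ?_, by simp, by simp, hp, ?_, ?_, ?_, ?_, by simp, [s], .refl _, ?_, by simp⟩
  · simp; exact .refl
  any_goals simp_all
  exact ⟨by simp, by simp, by simp [hn]⟩

end Label

/-! ### Second traversal: implementation -/

section LabelPass

variable {n : ℕ} {G : Digraph (Fin n)} {s : Fin n}

/-- The contents of the arrays during the second pass. -/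
structure LabelArrays (G : Digraph (Fin n)) (s : Fin n) (D : Set (Fin n × Fin n))
    (p next : Fin n → Fin n) (σ : State) : Prop where
  opens : ∀ x : Fin n, σ.arr 3 x = openCount G s D x
  label : ∀ x : Fin n, σ.arr 4 x = p x
  mark_le : ∀ x : Fin n, σ.arr 5 x ≤ 1
  mark : ∀ x : Fin n, σ.arr 5 x ≠ 0 ↔ x = s ∨ ∃ w, (w, x) ∈ D
  next : ∀ x : Fin n, σ.arr 6 x = next x
  source : σ.arr 7 0 = s

/-- Treat the arc from `u` to `v` as far as the count, the mark and the label of `v` go. -/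
def relabelCmd : Cmd :=
  .seq (.store 3 (.reg 8) (.sub (.get 3 (.reg 8)) (.lit 1)))
    (.ite (.get 5 (.reg 8))
      (.ite (.eq (.get 4 (.reg 8)) (.get 4 (.reg 5))) .skip (.store 4 (.reg 8) (.reg 8)))
      (.seq (.store 5 (.reg 8) (.lit 1)) (.store 4 (.reg 8) (.get 4 (.reg 5)))))

/-- Give `v` its final label. -/
def finalLabelCmd : Cmd :=
  .ite (.eq (.get 4 (.reg 8)) (.reg 2)) (.store 4 (.reg 8) (.reg 8)) .skip

/-- Insert `v` into the ring and into the queue. -/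
def insertCmd : Cmd :=
  .seq (.ite (.eq (.get 4 (.reg 8)) (.reg 8)) (.assign 9 (.reg 2)) (.assign 9 (.get 4 (.reg 8))))
    (.seq (.store 6 (.reg 8) (.get 6 (.reg 9)))
    (.seq (.store 6 (.reg 9) (.reg 8))
    (.seq (.store 2 (.reg 4) (.reg 8)) (.assign 4 (.add (.reg 4) (.lit 1))))))

/-- The treatment of an arc in the second pass. -/
def labelCmd : Cmd :=
  .seq relabelCmd (.ite (.get 3 (.reg 8)) .skip (.seq finalLabelCmd insertCmd))

variable {q : List (Fin n)} {D : Set (Fin n × Fin n)} {p next : Fin n → Fin n} {u v : Fin n}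
  {σ : State} {W m : ℕ}

theorem update_val {f : ℕ → ℕ} {g : Fin n → Fin n} (h : ∀ x : Fin n, f x = g x) (a b : Fin n)
    (x : Fin n) : Function.update f a b x = (Function.update g a b x : Fin n) := by
  by_cases hx : x = a
  · subst hx; simp
  · simp [hx, Fin.val_inj, h]

theorem openCount_le (D : Set (Fin n × Fin n)) (v : Fin n) : openCount G s D v ≤ n :=
  ncard_le_card _

theorem openCount_eq_zero {D : Set (Fin n × Fin n)} {v : Fin n} :
    openCount G s D v = 0 ↔ ∀ w, IsDescendant G s w → G.Adj w v → (w, v) ∈ D := by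
  rw [openCount, Set.ncard_eq_zero (Set.toFinite _), Set.eq_empty_iff_forall_notMem]
  simp

/-- The mark of `v` tells whether an earlier arc has set its label; the label cell cannot, because
an untouched cell holds 0, which is also a vertex. -/
theorem LabelArrays.runs_relabel (h : LabelArrays G s D p next σ) (hG : IsDAG G)
    (hW : n + m + 1 ≤ W)
    (hu : IsDescendant G s u) (huv : G.Adj u v) (hD : (u, v) ∉ D) (h5 : σ.reg 5 = u)
    (h8 : σ.reg 8 = v) :
    Runs W relabelCmd σ 30 (fun τ =>
      LabelArrays G s (insert (u, v) D) (relabel D p u v) next τ ∧ τ.reg = σ.reg ∧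
      τ.arr 0 = σ.arr 0 ∧ τ.arr 1 = σ.arr 1 ∧ τ.arr 2 = σ.arr 2) := by
  have hvs : v ≠ s := hG.ne_source hu huv
  have hm := h.mark v
  have hml := h.mark_le v
  have hp := h.label v
  have hpu := h.label u
  have ho := h.opens v
  have hol := openCount_le (G := G) (s := s) D v
  have hvn := v.isLt
  have hpn := (p v).isLt
  have hpun := (p u).isLt
  have hopens : ∀ x : Fin n, Function.update (σ.arr 3) v (σ.arr 3 v - 1) x =
      openCount G s (insert (u, v) D) x := by
    intro x
    rw [openCount_insert hD hu huv, ← h.opens]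
    by_cases hx : x = v
    · subst hx; simp
    · simp [hx, Fin.val_inj]
  have hmark : ∀ x : Fin n, x ≠ v →
      ((x = s ∨ ∃ w, (w, x) ∈ insert (u, v) D) ↔ (x = s ∨ ∃ w, (w, x) ∈ D)) := by
    intro x hx; simp [hx]
  by_cases hw : ∃ w, (w, v) ∈ D
  · replace hm : σ.arr 5 v = 1 := by have := hm.2 (.inr hw); omega
    have hmark' : ∀ x : Fin n, (x = s ∨ ∃ w, (w, x) ∈ insert (u, v) D) ↔
        (x = s ∨ ∃ w, (w, x) ∈ D) := by
      intro x
      by_cases hx : x = v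
      · subst hx
        exact iff_of_true (.inr ⟨u, .inl rfl⟩) (.inr hw)
      · exact hmark x hx
    by_cases e : p v = p u
    · refine (Runs.of_wp (Q := fun τ => τ = σ.setCell 3 v (σ.arr 3 v - 1)) ?_).mono
        (by simp [relabelCmd, Cmd.cost, Expr.cost]) ?_
      · simp [relabelCmd, Cmd.wp, Expr.Fits, Expr.val, State.setCell, h8, h5, hm, hp, hpu, e]
        omega
      · rintro τ rfl
        refine ⟨⟨hopens, ?_, ?_, ?_, ?_, ?_⟩, rfl, rfl, rfl, rfl⟩
        · have : relabel D p u v = p := by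
            rw [relabel, if_pos hw, if_pos e]; simp
          rw [this]; exact h.label
        · exact h.mark_le
        · intro x
          rw [hmark' x]
          exact h.mark x
        · exact h.next
        · exact h.source
    · refine (Runs.of_wp (Q := fun τ => τ = (σ.setCell 3 v (σ.arr 3 v - 1)).setCell 4 v v)
        ?_).mono (by simp [relabelCmd, Cmd.cost, Expr.cost]) ?_
      · simp [relabelCmd, Cmd.wp, Expr.Fits, Expr.val, State.setCell, h8, h5, hm, hp, hpu, e,
          Fin.val_inj]
        omega
      · rintro τ rfl
        refine ⟨⟨hopens, ?_, ?_, ?_, ?_, ?_⟩, rfl, rfl, rfl, rfl⟩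
        · have : relabel D p u v = Function.update p v v := by
            rw [relabel, if_pos hw, if_neg e]
          rw [this]; exact update_val h.label v v
        · exact h.mark_le
        · intro x
          rw [hmark' x]
          exact h.mark x
        · exact h.next
        · exact h.source
  · replace hm : σ.arr 5 v = 0 := by
      by_contra h0
      exact hw ((hm.1 h0).resolve_left hvs)
    refine (Runs.of_wp (Q := fun τ => τ = ((σ.setCell 3 v (σ.arr 3 v - 1)).setCell 5 v 1).setCell
        4 v (p u)) ?_).mono (by simp [relabelCmd, Cmd.cost, Expr.cost]) ?_
    · simp [relabelCmd, Cmd.wp, Expr.Fits, Expr.val, State.setCell, h8, h5, hm, hpu]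
      omega
    · rintro τ rfl
      refine ⟨⟨hopens, ?_, ?_, ?_, ?_, ?_⟩, rfl, rfl, rfl, rfl⟩
      · have : relabel D p u v = Function.update p v (p u) := by
          rw [relabel, if_neg hw]
        rw [this]; exact update_val h.label v (p u)
      · intro x
        by_cases hx : x = v
        · subst hx; simp [State.setCell]
        · simpa [State.setCell, Fin.val_inj, hx] using h.mark_le x
      · intro x
        by_cases hx : x = v
        · subst hx
          simp [State.setCell]
        · rw [hmark x hx, ← h.mark]
          simp [State.setCell, Fin.val_inj, hx]
      · exact h.next
      · exact h.source

theorem LabelArrays.runs_finalLabel (h : LabelArrays G s D p next σ) (hW : n + m + 1 ≤ W)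
    (h2 : σ.reg 2 = s) (h8 : σ.reg 8 = v) :
    Runs W finalLabelCmd σ 10 (fun τ =>
      LabelArrays G s D (finalLabel s p v) next τ ∧ τ.reg = σ.reg ∧
      τ.arr 0 = σ.arr 0 ∧ τ.arr 1 = σ.arr 1 ∧ τ.arr 2 = σ.arr 2) := by
  have hp := h.label v
  have hvn := v.isLt
  have hpn := (p v).isLt
  have hsn := s.isLt
  by_cases e : p v = s
  · refine (Runs.of_wp (Q := fun τ => τ = σ.setCell 4 v v) ?_).mono
      (by simp [finalLabelCmd, Cmd.cost, Expr.cost]) ?_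
    · simp [finalLabelCmd, Cmd.wp, Expr.Fits, Expr.val, h8, h2, hp, e]
      omega
    · rintro τ rfl
      refine ⟨⟨h.opens, ?_, h.mark_le, h.mark, h.next, h.source⟩, rfl, rfl, rfl, rfl⟩
      rw [finalLabel, if_pos e]
      exact update_val h.label v v
  · refine (Runs.of_wp (Q := fun τ => τ = σ) ?_).mono
      (by simp [finalLabelCmd, Cmd.cost, Expr.cost]) ?_
    · simp [finalLabelCmd, Cmd.wp, Expr.Fits, Expr.val, h8, h2, hp, e, Fin.val_inj]
      omega
    · rintro τ rfl
      refine ⟨⟨h.opens, ?_, h.mark_le, h.mark, h.next, h.source⟩, rfl, rfl, rfl, rfl⟩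
      rw [finalLabel, if_neg e]
      simpa using h.label

theorem LabelArrays.runs_insert (h : LabelArrays G s D p next σ) (hW : n + m + 1 ≤ W)
    (hq : q.length < n) (h2 : σ.reg 2 = s) (h4 : σ.reg 4 = q.length) (h8 : σ.reg 8 = v) :
    Runs W insertCmd σ 35 (fun τ =>
      LabelArrays G s D p (Function.update (Function.update next v (next (ringPred s p v)))
        (ringPred s p v) v) τ ∧ τ.reg 2 = s ∧ τ.reg 3 = σ.reg 3 ∧ τ.reg 4 = q.length + 1 ∧
      τ.reg 5 = σ.reg 5 ∧ τ.reg 6 = σ.reg 6 ∧ τ.reg 7 = σ.reg 7 ∧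
      τ.arr 0 = σ.arr 0 ∧ τ.arr 1 = σ.arr 1 ∧
      τ.arr 2 = Function.update (σ.arr 2) q.length v) := by
  have hp := h.label v
  have hvn := v.isLt
  have hpn := (p v).isLt
  have hsn := s.isLt
  have hn := h.next (ringPred s p v)
  have hnn := (next (ringPred s p v)).isLt
  have han := (ringPred s p v).isLt
  refine (Runs.of_wp (Q := fun τ => τ = ((((σ.setReg 9 (ringPred s p v)).setCell 6 v
      (next (ringPred s p v))).setCell 6 (ringPred s p v) v).setCell 2 q.length v).setReg 4
      (q.length + 1)) ?_).mono
      (by simp [insertCmd, Cmd.cost, Expr.cost]) ?_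
  · by_cases e : p v = v
    · have ha : ringPred s p v = s := if_pos e
      rw [ha] at hn hnn han ⊢
      simp [insertCmd, Cmd.wp, Expr.Fits, Expr.val, State.setReg, State.setCell, h8, h2, h4, hp, e,
        hn]
      omega
    · have ha : ringPred s p v = p v := if_neg e
      rw [ha] at hn hnn han ⊢
      simp [insertCmd, Cmd.wp, Expr.Fits, Expr.val, State.setReg, State.setCell, h8, h4, hp, e,
        hn, Fin.val_inj]
      omega
  · rintro τ rfl
    refine ⟨⟨h.opens, h.label, h.mark_le, h.mark, ?_, h.source⟩, ?_⟩
    · intro x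
      simpa [State.setReg, State.setCell] using
        update_val (update_val h.next v (next (ringPred s p v))) (ringPred s p v) v x
    · simp [State.setReg, State.setCell, h2]

/-- The invariant of the second pass. -/
def LabelState (G : Digraph (Fin n)) (s : Fin n) (q : List (Fin n)) (D : Set (Fin n × Fin n))
    (σ : State) : Prop :=
  ∃ p next, LabelInv G s q D p next ∧ LabelArrays G s D p next σ ∧ σ.reg 2 = s

/-- The open count after the decrement decides between the two steps of the invariant:
`LabelInv.push` if it is zero, `LabelInv.visit` otherwise. -/
theorem LabelState.arcSpec (hG : IsDAG G) {adj : Fin n → List (Fin n)}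
    (hadj : IsAdjacencyList G adj) (hW : n + m + 1 ≤ W) :
    ArcSpec W adj labelCmd 80 (LabelState G s) where
  nodup _ _ _ := fun ⟨_, _, h, _⟩ => h.nodup
  congr q D σ σ' h2 ha := fun ⟨p, next, h, hA, hs⟩ => ⟨p, next, h, ⟨ha ▸ hA.opens, ha ▸ hA.label,
    ha ▸ hA.mark_le, ha ▸ hA.mark, ha ▸ hA.next, ha ▸ hA.source⟩, h2 ▸ hs⟩
  runs q D σ u v hI hQ hu hv hD h5 h8 := by
    obtain ⟨p, next, hI, hA, h2⟩ := hI
    rw [hadj.mem_iff] at hv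
    have hvq := hI.notMem hG hu hv hD
    have hlt := length_lt_of_notMem hI.nodup hvq
    refine (Runs.seq (T₁ := 30) (T₂ := 50) (hA.runs_relabel hG hW (hI.desc u hu) hv hD h5 h8)
      ?_).mono le_rfl (fun _ h => h)
    rintro τ ⟨hA', hr, ha0, ha1, ha2⟩
    have ho := hA'.opens v
    have hol := openCount_le (G := G) (s := s) (insert (u, v) D) v
    have hvn := v.isLt
    have hfit : (Expr.get 3 (.reg 8)).Fits W τ := by
      simp only [Expr.Fits, Expr.val, hr, h8, ho]; omega
    have hval : (Expr.get 3 (.reg 8)).val τ = openCount G s (insert (u, v) D) v := by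
      simp only [Expr.val, hr, h8, ho]
    by_cases hz : openCount G s (insert (u, v) D) v = 0
    · have hpush := hI.push hG hu hv hD (openCount_eq_zero.1 hz)
      obtain ⟨t, τ', he, ht, hres⟩ := Runs.seq (hA'.runs_finalLabel hW (v := v) (by rw [hr, h2])
        (by rw [hr, h8])) (T₂ := 35) (Q := fun τ' => (∃ q', (q' = q ∨ q' = q ++ [v]) ∧
          LabelState G s q' (insert (u, v) D) τ' ∧
          HasQueue q' τ') ∧ τ'.arr 0 = σ.arr 0 ∧ τ'.arr 1 = σ.arr 1 ∧ τ'.reg 3 = σ.reg 3 ∧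
          τ'.reg 5 = σ.reg 5 ∧ τ'.reg 6 = σ.reg 6 ∧ τ'.reg 7 = σ.reg 7) (by
        rintro ρ ⟨hA'', hr', ha0', ha1', ha2'⟩
        refine (hA''.runs_insert hW hlt (v := v) (by rw [hr', hr, h2])
          (by rw [hr', hr, hQ.1]) (by rw [hr', hr, h8])).mono le_rfl ?_
        rintro π ⟨hB, b2, b3, b4, b5, b6, b7, c0, c1, c2⟩
        rw [hr', hr] at b3 b5 b6 b7
        exact ⟨⟨q ++ [v], .inr rfl, ⟨_, _, hpush.1, hB, b2⟩,
          hQ.concat b4 (by rw [c2, ha2', ha2])⟩, by rw [c0, ha0', ha0], by rw [c1, ha1', ha1],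
          b3, b5, b6, b7⟩)
      exact ⟨_, τ', .ite_false hfit (by rw [hval, hz]) he, by simp [Expr.cost]; omega, hres⟩
    · have hopen : ∃ w, IsDescendant G s w ∧ G.Adj w v ∧ (w, v) ∉ insert (u, v) D := by
        by_contra hc
        push Not at hc
        exact hz (openCount_eq_zero.2 hc)
      refine ⟨_, τ, .ite_true hfit (by rw [hval]; exact hz) (.skip τ), by simp [Expr.cost], ?_⟩
      exact ⟨⟨q, .inl rfl, ⟨_, _, hI.visit hG hu hv hD hopen, hA', by rw [hr, h2]⟩,
        hQ.congr (by rw [hr]) ha2⟩, ha0, ha1, by rw [hr], by rw [hr], by rw [hr], by rw [hr]⟩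

end LabelPass

/-! ### Listing the pairs along the ring -/

section Listing

variable {n : ℕ} {s : Fin n} {p next : Fin n → Fin n} {W : ℕ}

/-- Turns the local condition on consecutive vertices into a global one: up to `x`, the ring
consists of vertices with other labels, then the label of `x`, then further vertices of its set. A
vertex that is not its own label extends the decomposition of its predecessor. -/
theorem IsRing.exists_append_label {l : List (Fin n)} (h : IsRing s next l) (hs : p s = s)
    (hc : l.IsChain (fun a b => p b = b ∨ p a = p b)) : ∀ (k : ℕ) (A B : List (Fin n)) (x : Fin n),
    A.length = k → l = A ++ x :: B → ∃ A₁ A₂, A ++ [x] = A₁ ++ p x :: A₂ ∧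
      (∀ y ∈ A₁, p y ≠ p x) ∧ ∀ y ∈ A₂, p y = p x := by
  intro k
  induction k using Nat.strong_induction_on with
  | _ k ih =>
    intro A B x hk hl
    rcases List.eq_nil_or_concat A with rfl | ⟨A', a, rfl⟩
    · have : x = s := by simpa [hl] using h.head
      subst this
      exact ⟨[], [], by simp [hs], by simp, by simp⟩
    rw [List.concat_eq_append] at *
    have hax : p x = x ∨ p a = p x := by
      rw [hl, List.isChain_append] at hc
      exact hc.2.2 a (by simp) x (by simp)
    rcases hax with e | e
    · refine ⟨A' ++ [a], [], by rw [e], ?_, by simp⟩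
      -- If an earlier `y` had the label `x`, then by induction `x` would occur no later than `y`,
      -- hence twice in the ring.
      intro y hy he
      obtain ⟨C, E, hCE⟩ := List.append_of_mem hy
      have hlen : C.length < k := by rw [← hk, hCE]; simp
      obtain ⟨A₁, A₂, h1, -, -⟩ := ih C.length hlen C (E ++ x :: B) y rfl (by rw [hl, hCE]; simp)
      have hpy : p y ∈ C ++ [y] := by rw [h1]; simp
      have hxA : x ∈ A' ++ [a] := by
        rw [hCE, ← e, ← he]
        rcases List.mem_append.1 hpy with h | h
        · simp [h]
        · simp at h; simp [h]
      have hnd := h.nodup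
      rw [hl] at hnd
      exact (List.nodup_append.1 hnd).2.2 x hxA x (by simp) rfl
    · obtain ⟨A₁, A₂, h1, h2, h3⟩ := ih A'.length (by rw [← hk]; simp) A' (x :: B) a rfl
        (by rw [hl]; simp)
      rw [e] at h1 h2 h3
      refine ⟨A₁, A₂ ++ [x], by rw [h1]; simp, h2, ?_⟩
      intro y hy
      rcases List.mem_append.1 hy with hy | hy
      · exact h3 y hy
      · simp at hy; rw [hy]

/-- `L` lists the unordered pairs of elements of `A` with different labels, each once. -/
structure ListsPairs (p : Fin n → Fin n) (A : List (Fin n)) (L : List (Fin n × Fin n)) : Prop where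
  nodup : (L.map (fun e => s(e.1, e.2))).Nodup
  mem_iff : ∀ z, z ∈ L.map (fun e => s(e.1, e.2)) ↔ ∃ u ∈ A, ∃ v ∈ A, p u ≠ p v ∧ z = s(u, v)
  length_le : A.length ≤ L.length + 1

/-- The vertices of `A` with a label other than that of `x` are exactly those of `A₁`, so the new
row supplies all missing pairs. Being nonempty, it preserves the bound on the number of vertices. -/
theorem ListsPairs.concat {A A₁ A₂ : List (Fin n)} {x : Fin n} {L : List (Fin n × Fin n)}
    (h : ListsPairs p A L) (hnd : (A ++ [x]).Nodup) (hA : A ++ [x] = A₁ ++ p x :: A₂)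
    (h1 : ∀ y ∈ A₁, p y ≠ p x) (h2 : ∀ y ∈ A₂, p y = p x) (hpp : p (p x) = p x) (hne : A₁ ≠ []) :
    ListsPairs p (A ++ [x]) (L ++ A₁.map fun y => (x, y)) := by
  have hxA : x ∉ A := fun h => (List.nodup_append.1 hnd).2.2 x h x (by simp) rfl
  have hmem : ∀ y, y ∈ A₁ ↔ y ∈ A ∧ p y ≠ p x := by
    intro y
    have hy : y ∈ A ++ [x] ↔ y ∈ A₁ ++ p x :: A₂ := by rw [hA]
    simp only [List.mem_append, List.mem_cons, List.not_mem_nil, or_false] at hy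
    constructor
    · intro hyA
      refine ⟨?_, h1 y hyA⟩
      rcases hy.2 (.inl hyA) with h | h
      · exact h
      · exact (h1 y hyA (by rw [h])).elim
    · rintro ⟨hyA, hyp⟩
      rcases hy.1 (.inl hyA) with h | h | h
      · exact h
      · exact (hyp (by rw [h, hpp])).elim
      · exact (hyp (h2 y h)).elim
  have hmap : (L ++ A₁.map fun y => (x, y)).map (fun e => s(e.1, e.2)) =
      L.map (fun e => s(e.1, e.2)) ++ A₁.map fun y => s(x, y) := by simp
  have hnd1 : A₁.Nodup := by rw [hA] at hnd; exact (List.nodup_append.1 hnd).1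
  refine ⟨?_, ?_, ?_⟩
  · rw [hmap, List.nodup_append]
    refine ⟨h.nodup, hnd1.map fun a b hab => Sym2.congr_right.1 hab, ?_⟩
    rintro z hz z' hz' rfl
    obtain ⟨u, hu, v, hv, -, rfl⟩ := (h.mem_iff z).1 hz
    obtain ⟨y, -, hy⟩ := List.mem_map.1 hz'
    rcases Sym2.eq_iff.1 hy with ⟨e, -⟩ | ⟨e, -⟩
    · exact hxA (e ▸ hu)
    · exact hxA (e ▸ hv)
  · intro z
    rw [hmap, List.mem_append, h.mem_iff, List.mem_map]
    constructor
    · rintro (⟨u, hu, v, hv, huv, rfl⟩ | ⟨y, hy, rfl⟩)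
      · exact ⟨u, by simp [hu], v, by simp [hv], huv, rfl⟩
      · exact ⟨x, by simp, y, by simp [((hmem y).1 hy).1], ((hmem y).1 hy).2.symm, rfl⟩
    · rintro ⟨u, hu, v, hv, huv, rfl⟩
      simp only [List.mem_append, List.mem_singleton] at hu hv
      rcases hu with hu | rfl <;> rcases hv with hv | rfl
      · exact .inl ⟨u, hu, v, hv, huv, rfl⟩
      · exact .inr ⟨u, (hmem u).2 ⟨hu, huv⟩, Sym2.eq_swap⟩
      · exact .inr ⟨v, (hmem v).2 ⟨hv, huv.symm⟩, rfl⟩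
      · exact (huv rfl).elim
  · have := List.length_pos_iff.2 hne
    have := h.length_le
    simp
    omega

/-- The arrays hold the labelling `p` and the ring `next` starting at `s`. -/
structure HasRing (s : Fin n) (p next : Fin n → Fin n) (f : ℕ → ℕ → ℕ) : Prop where
  label : ∀ x : Fin n, f 4 x = p x
  next : ∀ x : Fin n, f 6 x = next x
  source : f 7 0 = s

/-- Print the pairs of the vertex in register `0` with the vertices of the ring before its label. -/
def printRowCmd : Cmd :=
  .while (.sub (.lit 1) (.eq (.reg 1) (.get 4 (.reg 0))))
    (.seq (.print (.reg 0) (.reg 1)) (.assign 1 (.get 6 (.reg 1))))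

/-- Print the rows of all vertices of the ring from the vertex in register `0` on. -/
def printRowsCmd : Cmd :=
  .while (.sub (.lit 1) (.eq (.reg 0) (.reg 2)))
    (.seq (.assign 1 (.reg 2)) (.seq printRowCmd (.assign 0 (.get 6 (.reg 0)))))

/-- Print all pairs of vertices of the ring with different labels. -/
def listCmd : Cmd :=
  .seq (.seq (.assign 2 (.get 7 (.lit 0))) (.assign 0 (.get 6 (.reg 2)))) printRowsCmd

/-- The printed form of a list of pairs. -/
def printed (L : List (Fin n × Fin n)) : List (ℕ × ℕ) := L.map fun e => ((e.1 : ℕ), (e.2 : ℕ))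

variable {f : ℕ → ℕ → ℕ}

theorem HasRing.runs_printRow (h : HasRing s p next f) (hW : n + 1 ≤ W) (x : Fin n) :
    ∀ (R : List (Fin n)) (y : Fin n) (σ : State), (R ++ [p x]).IsChain (fun a b => next a = b) →
      p x ∉ R → (R ++ [p x]).head? = some y → σ.arr = f → σ.reg 0 = x → σ.reg 1 = y →
      Runs W printRowCmd σ (14 * R.length + 7) (fun τ => τ.arr = f ∧ τ.reg 0 = x ∧
        τ.reg 2 = σ.reg 2 ∧ τ.out = σ.out ++ printed (R.map fun y => (x, y))) := by
  intro R
  have hxn := x.isLt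
  have hpn := (p x).isLt
  have hl := h.label x
  induction R with
  | nil =>
    intro y σ _ _ hy hf h0 h1
    have : p x = y := by simpa using hy
    subst this
    refine .while_false ?_ ?_ (by simp [Expr.cost]) ⟨hf, h0, rfl, by simp [printed]⟩
    · simp [Expr.Fits, Expr.val, h0, h1, hf, hl]; omega
    · simp [Expr.val, h0, h1, hf, hl]
  | cons z R ih =>
    intro y σ hc hx hy hf h0 h1
    have : z = y := by simpa using hy
    subst this
    have hzn := z.isLt
    have hzx : z ≠ p x := fun e => hx (by simp [e])
    rw [List.cons_append, List.isChain_cons] at hc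
    have hn := h.next z
    have hnn := (next z).isLt
    have hhead : (R ++ [p x]).head? = some (next z) := by
      cases R with
      | nil => simpa using (hc.1 (p x) (by simp)).symm
      | cons a R => simpa using (hc.1 a (by simp)).symm
    refine .while_true (T₁ := 6) (T₂ := 14 * R.length + 7)
      (R := fun τ => τ = (σ.print x z).setReg 1 (next z)) ?_ ?_ ?_ ?_ ?_
    · simp [Expr.Fits, Expr.val, h0, h1, hf, hl]; omega
    · simp [Expr.val, h0, h1, hf, hl, Fin.val_inj, hzx]
    · refine (Runs.of_wp ?_).mono (Q := fun τ => τ = (σ.print x z).setReg 1 (next z))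
        (by simp [Cmd.cost, Expr.cost]) (fun _ h => h)
      simp [Cmd.wp, Expr.Fits, Expr.val, State.setReg, State.print, h0, h1, hf, hn]
      omega
    · rintro τ rfl
      refine (ih (next z) _ hc.2 (fun e => hx (by simp [e])) hhead ?_ ?_ ?_).mono le_rfl ?_
      any_goals simp [State.setReg, State.print, hf, h0]
      intro τ' a0 a1 a2 a3
      exact ⟨a0, a1, a2, by simp [a3, printed]⟩
    · simp [Expr.cost]; omega

/-- Induction on the vertices `B` whose rows are still to be printed. A row costs 18 plus 14 for
each pair in it. The final list is fixed before the state, as it depends on the ring alone. -/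
theorem HasRing.runs_printRows (h : HasRing s p next f) (hW : n + 1 ≤ W) {l : List (Fin n)}
    (hr : IsRing s next l) (hc : l.IsChain (fun a b => p b = b ∨ p a = p b)) (hs : p s = s)
    (hpp : ∀ v ∈ l, p (p v) = p v) (hne : ∀ v ∈ l, v ≠ s → p v ≠ s) :
    ∀ (B A : List (Fin n)) (L : List (Fin n × Fin n)), l = A ++ B → A ≠ [] → ListsPairs p A L →
      ∃ L', ListsPairs p l L' ∧ L.length ≤ L'.length ∧ ∀ (y : Fin n) (σ : State), σ.arr = f →
        (B ++ [s]).head? = some y → σ.reg 0 = y → σ.reg 2 = s →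
        Runs W printRowsCmd σ (18 * B.length + 14 * (L'.length - L.length) + 6)
          (fun τ => τ.arr = f ∧ ∃ M, L' = L ++ M ∧ τ.out = σ.out ++ printed M) := by
  intro B
  have hsn := s.isLt
  induction B with
  | nil =>
    intro A L hl hA hL
    refine ⟨L, by simpa [hl] using hL, le_rfl, ?_⟩
    intro y σ hf hy h0 h2
    have : s = y := by simpa using hy
    subst this
    refine .while_false ?_ ?_ (by simp [Expr.cost]) ⟨hf, [], by simp, by simp [printed]⟩
    · simp [Expr.Fits, h0, h2]; omega
    · simp [Expr.val, h0, h2]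
  | cons x B ih =>
    intro A L hl hA hL
    have hnd := hr.nodup
    have hl' : l = (A ++ [x]) ++ B := by simp [hl]
    obtain ⟨A₁, A₂, hAx, h1, h2⟩ := hr.exists_append_label hs hc _ A B x rfl hl
    have hxl : x ∈ l := by simp [hl]
    have hAhead : A.head? = some s := by
      have := hr.head
      rw [hl] at this
      cases A with
      | nil => exact (hA rfl).elim
      | cons a A => simpa using this
    have hxs : x ≠ s := by
      rintro rfl
      rw [hl] at hnd
      exact (List.nodup_append.1 hnd).2.2 x (List.mem_of_head? hAhead) x (by simp) rfl
    -- The label of `x` is not $s$, so the row starts with $s$ and is not empty.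
    have hA₁head : A₁.head? = some s := by
      cases A₁ with
      | nil =>
        exfalso
        have : (A ++ [x]).head? = some (p x) := by rw [hAx]; simp
        rw [List.head?_append, hAhead] at this
        exact hne x hxl hxs (by simpa using this.symm)
      | cons a A₁ =>
        have : (A ++ [x]).head? = some a := by rw [hAx]; simp
        rw [List.head?_append, hAhead] at this
        simpa using this.symm
    have hA₁ : A₁ ≠ [] := by rintro rfl; simp at hA₁head
    have hnd' : (A ++ [x]).Nodup := by rw [hl'] at hnd; exact (List.nodup_append.1 hnd).1
    obtain ⟨L', hL', hle, hrun⟩ := ih (A ++ [x]) _ hl' (by simp)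
      (hL.concat hnd' hAx h1 h2 (hpp x hxl) hA₁)
    simp only [List.length_append, List.length_map] at hle
    refine ⟨L', hL', by omega, ?_⟩
    intro y σ hf hy h0 hr2
    have : x = y := by simpa using hy
    subst this
    have hxn := x.isLt
    have hn := h.next x
    have hnn := (next x).isLt
    have hchain := hr.chain
    have hrow : (A₁ ++ [p x]).IsChain (fun a b => next a = b) := by
      have e : l ++ [s] = (A₁ ++ [p x]) ++ (A₂ ++ B ++ [s]) := by
        rw [hl', hAx]; simp
      rw [e, List.isChain_append] at hchain
      exact hchain.1
    have hnext : (B ++ [s]).head? = some (next x) := by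
      have e : l ++ [s] = A ++ x :: (B ++ [s]) := by rw [hl]; simp
      rw [e, List.isChain_split, List.isChain_cons] at hchain
      cases B with
      | nil => simpa using (hchain.2.1 s (by simp)).symm
      | cons b B => simpa using (hchain.2.1 b (by simp)).symm
    have hpA₁ : p x ∉ A₁ := fun e => h1 _ e (hpp x hxl)
    refine .while_true (T₁ := 2 + ((14 * A₁.length + 7) + 3))
      (T₂ := 18 * B.length + 14 * (L'.length - (L.length + A₁.length)) + 6)
      (R := fun τ => τ.arr = f ∧ τ.reg 0 = next x ∧ τ.reg 2 = s ∧
        τ.out = σ.out ++ printed (A₁.map fun y => (x, y))) ?_ ?_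
      (.seq (R := fun τ => τ = σ.setReg 1 s) ?_ ?_) ?_ ?_
    · simp [Expr.Fits, h0, hr2]; omega
    · simp [Expr.val, h0, hr2, Fin.val_inj, hxs]
    · refine (Runs.of_wp ?_).mono (Q := fun τ => τ = σ.setReg 1 s)
        (by simp [Cmd.cost, Expr.cost]) (fun _ h => h)
      simp [Cmd.wp, Expr.Fits, Expr.val, hr2]
      omega
    · rintro τ rfl
      refine .seq (h.runs_printRow hW x A₁ s _ hrow hpA₁ ?_ ?_ ?_ ?_) ?_
      · rw [List.head?_append, hA₁head]; rfl
      any_goals simp [State.setReg, hf, h0]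
      intro τ a0 a1 a2 a3
      refine (Runs.of_wp ?_).mono (Q := fun τ => τ.arr = f ∧ τ.reg 0 = next x ∧ τ.reg 2 = s ∧
        τ.out = σ.out ++ printed (A₁.map fun y => (x, y)))
        (by simp [Cmd.cost, Expr.cost]) (fun _ h => h)
      simp [Cmd.wp, Expr.Fits, Expr.val, State.setReg, a0, a1, a2, a3, hr2, hn]
      omega
    · rintro τ ⟨a0, a1, a2, a3⟩
      have := hrun (next x) τ a0 hnext a1 a2
      simp only [List.length_append, List.length_map] at this
      refine this.mono le_rfl ?_
      rintro τ' ⟨b0, M, hM, hout⟩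
      exact ⟨b0, A₁.map (fun y => (x, y)) ++ M, by simp [hM], by simp [hout, a3, printed]⟩
    · simp [Expr.cost]
      obtain ⟨r, hr⟩ := Nat.exists_eq_add_of_le hle
      rw [show L'.length - (L.length + A₁.length) = r by omega,
        show L'.length - L.length = A₁.length + r by omega]
      omega

/-- The number of rows is at most the number of pairs, so the cost 18 of a row is charged to a pair:
32 = 18 + 14. The source is read from array `7`, because the registers are arbitrary when the
listing starts. -/
theorem HasRing.runs_list (h : HasRing s p next f) (hW : n + 1 ≤ W) {l : List (Fin n)}
    (hr : IsRing s next l) (hc : l.IsChain (fun a b => p b = b ∨ p a = p b)) (hs : p s = s)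
    (hpp : ∀ v ∈ l, p (p v) = p v) (hne : ∀ v ∈ l, v ≠ s → p v ≠ s) :
    ∃ L, ListsPairs p l L ∧ ∀ σ : State, σ.arr = f →
      Runs W listCmd σ (32 * L.length + 13)
          (fun τ => τ.arr = f ∧ τ.out = σ.out ++ printed L) := by
  obtain ⟨t, rfl⟩ : ∃ t, l = s :: t := by
    have := hr.head
    cases l with
    | nil => simp at this
    | cons a t => exact ⟨t, by simpa using this⟩
  have h0 : ListsPairs p [s] [] := by
    refine ⟨by simp, ?_, by simp⟩
    simp
  obtain ⟨L, hL, -, hrun⟩ := h.runs_printRows hW hr hc hs hpp hne t [s] [] rfl (by simp) h0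
  refine ⟨L, hL, fun σ hf => ?_⟩
  have hlen := hL.length_le
  have hsn := s.isLt
  have hn := h.next s
  have hnn := (next s).isLt
  have hsrc := h.source
  have hnext : (t ++ [s]).head? = some (next s) := by
    have hchain := hr.chain
    rw [List.cons_append, List.isChain_cons] at hchain
    cases t with
    | nil => simpa using (hchain.1 s (by simp)).symm
    | cons b B => simpa using (hchain.1 b (by simp)).symm
  refine (Runs.seq (T₁ := 6) (R := fun τ => τ = (σ.setReg 2 s).setReg 0 (next s)) ?_ ?_).mono
    (T := 6 + (18 * t.length + 14 * L.length + 6)) ?_ (fun _ h => h)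
  · refine (Runs.of_wp ?_).mono (Q := fun τ => τ = (σ.setReg 2 s).setReg 0 (next s))
      (by simp [Cmd.cost, Expr.cost]) (fun _ h => h)
    simp [Cmd.wp, Expr.Fits, Expr.val, State.setReg, hf, hsrc, hn]
    omega
  · rintro τ rfl
    refine (hrun (next s) _ ?_ hnext ?_ ?_).mono (by simp) ?_
    any_goals simp [State.setReg, hf]
  · simp at hlen
    omega

end Listing

/-! ### The input as adjacency lists -/

section Input

variable {n : ℕ} {adj : Fin n → List (Fin n)}

theorem arcCount_eq_sum {G : Digraph (Fin n)} (h : IsAdjacencyList G adj) :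
    arcCount G = ∑ u, (adj u).length := by
  classical
  have : {e : Fin n × Fin n | G.Adj e.1 e.2} =
      ((Finset.univ.sigma fun u => (adj u).toFinset).map
        (Equiv.sigmaEquivProd (Fin n) (Fin n)).toEmbedding : Finset (Fin n × Fin n)) := by
    ext ⟨u, v⟩
    simp [h.mem_iff]
  rw [arcCount, this, Set.ncard_coe_finset, Finset.card_map, Finset.card_sigma]
  exact Finset.sum_congr rfl fun u _ => List.toFinset_card_of_nodup (h.nodup u)

theorem length_flatten_ofFn : (List.ofFn adj).flatten.length = ∑ u, (adj u).length := by
  rw [List.length_flatten, List.map_ofFn, List.sum_ofFn]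
  rfl

theorem hasAdjacency_inputState (s : Fin n) :
    HasAdjacency adj (∑ u, (adj u).length) ((inputState adj s).arr 0)
      ((inputState adj s).arr 1) := by
  have htake : ∀ u : Fin n, (List.ofFn adj).take (u + 1) = (List.ofFn adj).take u ++ [adj u] := by
    intro u
    rw [List.take_succ_eq_append_getElem (by simp)]
    simp
  have hsplit : ∀ u : Fin n, (List.ofFn adj).flatten = ((List.ofFn adj).take u).flatten ++
      (adj u ++ ((List.ofFn adj).drop (u + 1)).flatten) := by
    intro u
    conv_lhs => rw [← List.take_append_drop (u + 1) (List.ofFn adj)]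
    rw [htake]
    simp
  have hoff : ∀ i ≤ n, (inputState adj s).arr 0 i = ((List.ofFn adj).take i).flatten.length := by
    intro i hi
    simp [inputState, hi]
  have harc : ∀ i, (inputState adj s).arr 1 i = ((List.ofFn adj).flatten.map Fin.val).getD i 0 := by
    intro i
    simp [inputState]
  refine ⟨?_, ?_, ?_, rfl⟩
  · intro u
    rw [hoff _ u.isLt, hoff _ u.isLt.le, htake]
    simp
  · intro u
    rw [hoff _ u.isLt, ← length_flatten_ofFn]
    conv_rhs => rw [← List.take_append_drop (u + 1) (List.ofFn adj)]
    rw [List.flatten_append, List.length_append]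
    exact Nat.le_add_right _ _
  · intro u i hi
    rw [harc, hoff _ u.isLt.le, hsplit u, List.map_append,
      List.getD_append_right _ _ _ _ (by rw [List.length_map]; exact Nat.le_add_right _ _),
      List.length_map, Nat.add_sub_cancel_left, List.map_append]
    rw [List.getD_append _ _ _ _ (by simpa using hi), List.getD_eq_getElem _ _ (by simpa using hi)]
    simp

end Input

/-! ### The complete programs -/

section Programs

variable {n : ℕ} {G : Digraph (Fin n)} {s : Fin n} {W m : ℕ}

/-- Let the queue consist of the vertex in register `2`. -/
def initQueueCmd : Cmd :=
  .seq (.store 2 (.lit 0) (.reg 2)) (.seq (.assign 3 (.lit 0)) (.assign 4 (.lit 1)))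

/-- Label, mark and link the vertex in register `2`. -/
def initLabelCmd : Cmd :=
  .seq initQueueCmd (.seq (.store 4 (.reg 2) (.reg 2)) (.seq (.store 5 (.reg 2) (.lit 1))
    (.seq (.store 6 (.reg 2) (.reg 2)) (.store 7 (.lit 0) (.reg 2)))))

/-- Construct the labelling, the marks of the descendants, and the ring. -/
def buildCmd : Cmd :=
  .seq (.seq initQueueCmd (exploreCmd countCmd)) (.seq initLabelCmd (exploreCmd labelCmd))

/-- Decide whether the vertices in the registers `0` and `1` are marked and have different labels. -/
def queryCmd : Cmd :=
  .ite (.get 5 (.reg 0))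
    (.ite (.get 5 (.reg 1))
      (.ite (.eq (.get 4 (.reg 0)) (.get 4 (.reg 1))) (.assign 0 (.lit 0)) (.assign 0 (.lit 1)))
      (.assign 0 (.lit 0)))
    (.assign 0 (.lit 0))

theorem runs_initQueue {σ : State} (hW : n + 1 ≤ W) (h2 : σ.reg 2 = s) :
    Runs W initQueueCmd σ 7 (fun τ => τ.reg 3 = 0 ∧ τ.reg 2 = s ∧ HasQueue [s] τ ∧
      ∀ a, a ≠ 2 → τ.arr a = σ.arr a) := by
  have := s.isLt
  refine (Runs.of_wp ?_).mono (by simp [initQueueCmd, Cmd.cost, Expr.cost]) (fun _ h => h)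
  simp [initQueueCmd, Cmd.wp, Expr.Fits, Expr.val, State.setReg, State.setCell, h2, HasQueue]
  exact ⟨by omega, by omega, fun a ha => Function.update_of_ne ha _ _⟩

theorem runs_initLabel {σ : State} {q : List (Fin n)} {D : Set (Fin n × Fin n)} (hW : n + 1 ≤ W)
    (h : CountInv G s q D σ) (ho : ∀ v : Fin n, σ.arr 3 v = openCount G s ∅ v) :
    Runs W initLabelCmd σ 19 (fun τ => τ.reg 3 = 0 ∧ HasQueue [s] τ ∧ LabelState G s [s] ∅ τ ∧
      τ.arr 0 = σ.arr 0 ∧ τ.arr 1 = σ.arr 1) := by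
  have hs := s.isLt
  refine Runs.seq (T₁ := 7) (T₂ := 12) (runs_initQueue hW h.source) ?_
  rintro τ ⟨h3, h2, hQ, ha⟩
  have hz : ∀ a, 4 ≤ a → ∀ i, τ.arr a i = 0 := fun a h4 i => by
    rw [ha a (by omega), h.zero a h4]
  refine (Runs.of_wp (Q := fun π => π = (((τ.setCell 4 s s).setCell 5 s 1).setCell 6 s s).setCell
    7 0 s) ?_).mono (by simp [Cmd.cost, Expr.cost]) ?_
  · simp [Cmd.wp, Expr.Fits, Expr.val, State.setCell, h2]
    omega
  · rintro π rfl
    -- The zeros in memory are read as the vertex 0, so that labels and links are total functions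
    -- without any initialization; these values are meaningless except at $s$.
    let z : Fin n → Fin n := fun _ => ⟨0, s.pos⟩
    have hz4 : ∀ x : Fin n, τ.arr 4 x = z x := fun x => hz 4 le_rfl x
    have hz6 : ∀ x : Fin n, τ.arr 6 x = z x := fun x => hz 6 (by omega) x
    refine ⟨h3, hQ.congr rfl rfl, ⟨Function.update z s s, Function.update z s s,
      .init G (by simp) (by simp), ⟨?_, ?_, ?_, ?_, ?_, ?_⟩, h2⟩, ha 0 (by omega), ha 1 (by omega)⟩
    · intro x
      rw [← ho, ← ha 3 (by omega)]
      rfl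
    · exact update_val hz4 s s
    · intro x
      by_cases hx : x = s
      · subst hx; simp [State.setCell]
      · simp [State.setCell, Fin.val_inj, hx, hz]
    · intro x
      by_cases hx : x = s
      · subst hx; simp [State.setCell]
      · simp [State.setCell, Fin.val_inj, hx, hz]
    · exact update_val hz6 s s
    · simp [State.setCell]

theorem runs_build {adj : Fin n → List (Fin n)} (hG : IsDAG G) (hadj : IsAdjacencyList G adj)
    (hW : n + arcCount G + 1 ≤ W) :
    Runs W buildCmd (inputState adj s) (300 * (arcCount G + 1)) (fun σ =>
      ∃ q, LabelState G s q (arcsFrom adj q) σ) := by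
  have hA := hasAdjacency_inputState (adj := adj) s
  rw [← arcCount_eq_sum hadj] at hA
  refine (Runs.seq (T₁ := 7 + 70 * (arcCount G + 1)) (T₂ := 19 + 120 * (arcCount G + 1))
    (R := fun τ => (∃ q, CountInv G s q (arcsFrom adj q) τ) ∧
      τ.arr 0 = (inputState adj s).arr 0 ∧ τ.arr 1 = (inputState adj s).arr 1)
    (Runs.seq (runs_initQueue (n := n) (s := s) (by omega) rfl) ?_) ?_).mono (by omega)
    (fun _ h => h)
  · rintro τ ⟨h3, h2, hQ, ha⟩
    refine (CountInv.arcSpec hG hadj hW).runs_explore hA hW hadj.nodup (s := s) ?_ hQ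
      (ha 0 (by omega)) (ha 1 (by omega)) h3
    refine ⟨by simp, ?_, by simp, ?_, ?_, h2⟩
    · simp; exact .refl
    · intro v
      rw [ha 3 (by omega)]
      simp [inputState]
    · intro a h4 i
      rw [ha a (by omega)]
      simp [inputState, show a ≠ 0 by omega, show a ≠ 1 by omega]
  · rintro τ ⟨⟨q, hq⟩, h0, h1⟩
    refine Runs.seq (runs_initLabel (by omega) hq (hq.count_eq hadj)) ?_
    rintro π ⟨h3, hQ, hL, b0, b1⟩
    exact ((LabelState.arcSpec hG hadj hW).runs_explore hA hW hadj.nodup hL hQ (b0.trans h0)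
      (b1.trans h1) h3).mono le_rfl fun _ h => h.1

-- The marks are tested first, since the label cell of a vertex that is not a descendant means
-- nothing.
open Classical in
theorem runs_query {p : Fin n → Fin n} (hW : n + 1 ≤ W) {τ : State} {u v : Fin n}
    (hm : ∀ x : Fin n, τ.arr 5 x ≤ 1 ∧ (τ.arr 5 x ≠ 0 ↔ IsDescendant G s x))
    (hp : ∀ x : Fin n, τ.arr 4 x = p x) (h0 : τ.reg 0 = u) (h1 : τ.reg 1 = v) :
    Runs W queryCmd τ 30 (fun τ' => τ' = τ.setReg 0
      (if IsDescendant G s u ∧ IsDescendant G s v ∧ p u ≠ p v then 1 else 0)) := by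
  refine (Runs.of_wp ?_).mono (by simp [queryCmd, Cmd.cost, Expr.cost]) (fun _ h => h)
  have hu := u.isLt
  have hv := v.isLt
  have hpu := (p u).isLt
  have hpv := (p v).isLt
  have hmu := (hm u).1
  have hmv := (hm v).1
  simp only [queryCmd, Cmd.wp, Expr.Fits, Expr.val, h0, h1, hp, (hm _).2, Fin.val_inj]
  refine ⟨by omega, fun hdu => ⟨by omega, fun hdv => ⟨by omega, fun he => ⟨by omega, ?_⟩,
    fun he => ⟨by omega, ?_⟩⟩, fun hdv => ⟨by omega, ?_⟩⟩, fun hdu => ⟨by omega, ?_⟩⟩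
  · have : p u = p v := by by_contra h; simp [h] at he
    simp [this]
  · have : p u ≠ p v := by intro h; simp [h] at he
    simp [hdu, hdv, this]
  · have : ¬ IsDescendant G s v := fun h => (hm v).2.2 h hdv
    simp [this]
  · have : ¬ IsDescendant G s u := fun h => (hm u).2.2 h hdu
    simp [this]

end Programs

/-! ### Assembly -/

theorem theorem1 :
    ∃ (build query listAll : RAM.Cmd) (p C : ℕ),
      ∀ (n : ℕ) (G : Digraph (Fin n)) (adj : Fin n → List (Fin n)) (s : Fin n),
        IsDAG G → IsAdjacencyList G adj →
        ∃ (σ : RAM.State) (t : ℕ),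
          -- the construction takes time `O(m)` and yields a disjoint-set structure
          RAM.Exec (C * (n + arcCount G + 1)) build (inputState adj s) t σ ∧
          t ≤ C * (arcCount G + 1) ∧
          IsDisjointSetArray G s (σ.arr p) ∧
          -- from then on, whatever the registers contain, any query takes constant time
          (∀ (τ : RAM.State) (u v : Fin n), τ.arr = σ.arr → τ.reg 0 = u → τ.reg 1 = v →
            ∃ (τ' : RAM.State) (t' : ℕ),
              RAM.Exec (C * (n + arcCount G + 1)) query τ t' τ' ∧
              t' ≤ C ∧
              τ'.arr = τ.arr ∧ τ'.out = τ.out ∧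
              (IsJunction G s u v → τ'.reg 0 = 1) ∧
              (¬ IsJunction G s u v → τ'.reg 0 = 0)) ∧
          -- and all `k` pairs with junction `s` are printed, each once, in time `O(k)`
          (∀ τ : RAM.State, τ.arr = σ.arr →
            ∃ (τ' : RAM.State) (t' : ℕ) (L : List (Fin n × Fin n)),
              RAM.Exec (C * (n + arcCount G + 1)) listAll τ t' τ' ∧
              t' ≤ C * ((junctionPairs G s).ncard + 1) ∧
              τ'.arr = τ.arr ∧
              τ'.out = τ.out ++ L.map (fun e => ((e.1 : ℕ), (e.2 : ℕ))) ∧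
              (L.map (fun e => s(e.1, e.2))).Nodup ∧
              (∀ z : Sym2 (Fin n), z ∈ L.map (fun e => s(e.1, e.2)) ↔ z ∈ junctionPairs G s)) := by
  -- The labels are in array `4`. The constant 300 comes from the construction, which needs at most
  -- 26 + 190 (m + 1) steps; it exceeds the constants 30 and 32 of the other programs, and words up
  -- to n + m + 1 would suffice.
  refine ⟨buildCmd, queryCmd, listCmd, 4, 300, fun n G adj s hG hadj => ?_⟩
  have hW : n + arcCount G + 1 ≤ 300 * (n + arcCount G + 1) := by omega
  obtain ⟨t, σ, hexec, ht, q, p, next, hI, hA, -⟩ := runs_build (s := s) hG hadj hW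
  have hD : ∀ w v, w ∈ q → G.Adj w v → (w, v) ∈ arcsFrom adj q :=
    fun w v hw hwv => ⟨hw, (hadj.mem_iff _ _).2 hwv⟩
  have hlab := hI.isLabelling hG hD
  have hq := hI.mem_iff hG hD
  have hj : ∀ u v, IsJunction G s u v ↔ IsDescendant G s u ∧ IsDescendant G s v ∧ p u ≠ p v :=
    fun u v => ⟨fun h => ⟨h.isDescendant.1, h.isDescendant.2,
      (hlab.isJunction_iff hG h.isDescendant.1 h.isDescendant.2).1 h⟩,
      fun ⟨hu, hv, h⟩ => (hlab.isJunction_iff hG hu hv).2 h⟩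
  -- A mark only says that some arc into the vertex has been treated; at the end this characterizes
  -- the descendants, since the tails of treated arcs are descendants and every queued vertex other
  -- than $s$ has such an arc.
  have hmark : ∀ x : Fin n, σ.arr 5 x ≠ 0 ↔ IsDescendant G s x := by
    intro x
    rw [hA.mark, ← hq]
    constructor
    · rintro (rfl | ⟨w, hw⟩)
      · exact hI.source_mem
      · exact (hq x).2 (Relation.ReflTransGen.tail (hI.desc w hw.1) (hI.tail w x hw).2)
    · intro hx
      exact ((hI.mem x).1 hx).imp id And.left
  refine ⟨σ, t, hexec, ht, ⟨?_, ?_⟩, ?_, ?_⟩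
  · intro v hv
    have hvq := (hq v).2 hv
    exact ⟨p v, (hq _).1 (hI.label_mem v hvq), hA.label v, by rw [hA.label, hI.label_label v hvq]⟩
  · intro u v hu hv
    rw [hA.label, hA.label, Ne, Fin.val_inj]
    exact hlab.isJunction_iff hG hu hv
  · intro τ u v hτ h0 h1
    classical
    obtain ⟨t', τ', he, ht', rfl⟩ := runs_query (G := G) (s := s) (p := p)
      (W := 300 * (n + arcCount G + 1)) (by omega) (τ := τ)
      (fun x => by rw [hτ]; exact ⟨hA.mark_le x, hmark x⟩) (fun x => by rw [hτ]; exact hA.label x)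
      h0 h1
    refine ⟨_, t', he, by omega, rfl, rfl, fun h => ?_, fun h => ?_⟩
    · simpa [State.setReg] using (hj u v).1 h
    · rw [hj] at h
      simp only [RAM.State.setReg, Function.update_self, if_neg h]
  · obtain ⟨l, hl, hr, hc⟩ := hI.ring
    have hlq : ∀ {x}, x ∈ l ↔ x ∈ q := hl.mem_iff
    obtain ⟨L, hL, hrun⟩ := HasRing.runs_list (f := σ.arr) (s := s) (p := p) (next := next)
      (W := 300 * (n + arcCount G + 1)) ⟨hA.label, hA.next, hA.source⟩ (by omega) hr hc hI.source
      (fun v hv => hI.label_label v (hlq.1 hv)) (fun v hv => hI.ne_source v (hlq.1 hv))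
    have hmem : ∀ z : Sym2 (Fin n), z ∈ L.map (fun e => s(e.1, e.2)) ↔ z ∈ junctionPairs G s := by
      intro z
      rw [hL.mem_iff]
      constructor
      · rintro ⟨u, hu, v, hv, hne, rfl⟩
        exact ⟨u, v, rfl, (hj u v).2 ⟨(hq u).1 (hlq.1 hu), (hq v).1 (hlq.1 hv), hne⟩⟩
      · rintro ⟨u, v, rfl, h⟩
        obtain ⟨hu, hv, hne⟩ := (hj u v).1 h
        exact ⟨u, hlq.2 ((hq u).2 hu), v, hlq.2 ((hq v).2 hv), hne, rfl⟩
    have hcard : (junctionPairs G s).ncard = L.length := by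
      classical
      have : junctionPairs G s = ((L.map (fun e => s(e.1, e.2))).toFinset : Set (Sym2 (Fin n))) := by
        ext z
        rw [← hmem z]
        simp
      rw [this, Set.ncard_coe_finset, List.toFinset_card_of_nodup hL.nodup, List.length_map]
    intro τ hτ
    obtain ⟨t', τ', he, ht', ha, hout⟩ := hrun τ hτ
    exact ⟨τ', t', L, he, by rw [hcard]; omega, ha.trans hτ.symm, hout, hL.nodup, hmem⟩
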